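/- **Setting.** Let $\mathcal B_\infty$ be the rooted infinite binary tree with root $o$. For a finite rooted subtree $T\ni o$ of $\mathcal B_\infty$, a stable configuration is $\eta\in\{1,2,3\}^T$; it is recurrent (allowed) if there is no nonempty $S\subseteq T$ such that for every $u\in S$ the height $\eta_u$ is at most the number of neighbours of $u$ in $S$. Let $\mu_T$ be the uniform measure on the recurrent configurations of $T$; for an infinite rooted subtree $T$ let $\mu_T$ be the weak limit of $\mu_{T'}$ along the net of finite rooted subtrees $T'\uparrow T$. Let $Cov(u,v,T)$ be the covariance of $\eta_u$ and $\eta_v$ under $\mu_T$. A recurrent configuration of a finite rooted tree $T$ is strongly allowed if it remains allowed after attaching to the root of $T$ a new vertex of height $1$, and weakly allowed otherwise; the characteristic ratio $x(T)$ is the number of weakly allowed configurations divided by the number of strongly allowed ones. Let $p\in(0,1]$ and let $\mathcal T$ be the random binary tree with root $o$: each individual independently has two children with probability $p$ and none with probability $1-p$. Let $\mathcal T_N$ be its restriction to the generations $0,\dots,N$. For each $n$ let $v(n)$ be a fixed vertex of $\mathcal B_\infty$ at distance $n$ from $o$, and let $\mathcal T[o,n]$ be $\mathcal T$ conditioned to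 contain $v(n)$, that is, to contain the path from $o$ to $v(n)$. **Theorem.** The random variables $x(\mathcal T_N)$ converge in distribution as $N\to\infty$; let $x_1$ have the limiting law, and let $\gamma$ be given by $\gamma^{-1}=\mathbb E\big((1+x_1)^{-1}\big)$. The measure $\mu_T$ exists for every finite or infinite rooted subtree $T$ of $\mathcal B_\infty$. For every $n$, $Cov(o,v(n),\mathcal T[o,n])$ is integrable and $\mathbb E|Cov(o,v(n),\mathcal T[o,n])|>0$, the limit below exists, and $$\lim_{n\to\infty}\frac1n\Big(-\log \mathbb E\big|Cov(o,v(n),\mathcal T[o,n])\big|\Big)\le \log\frac{\Lambda_+(\gamma)}{\Lambda_-(\gamma)}\le\log\frac{4+\sqrt7}{4-\sqrt7},\qquad \Lambda_\pm(\gamma)=\frac{2\gamma+1\pm\sqrt{4\gamma+1}}2 .$$ -/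

import Mathlib

open MeasureTheory ProbabilityTheory Filter Topology

noncomputable section

namespace TreeSandpile

/-- Vertices of the rooted infinite binary tree: finite binary words. The root is `[]`, the
children of `u` are `u ++ [false]` and `u ++ [true]`, and `u.length` is the distance from
the root to `u`. -/
abbrev Vertex := List Bool

/-- The rooted infinite binary tree as a graph. -/
def binaryTree : SimpleGraph Vertex where
  Adj u v := (∃ b, v = u ++ [b]) ∨ (∃ b, u = v ++ [b])
  symm := ⟨fun _ _ h => h.symm⟩
  loopless := ⟨by rintro u (⟨b, h⟩ | ⟨b, h⟩) <;> simp at h⟩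

/-- Rooted subtrees of the infinite binary tree: sets of vertices that contain the root and,
with every vertex, all its ancestors. -/
def IsRootedSubtree (T : Set Vertex) : Prop :=
  [] ∈ T ∧ ∀ u v : Vertex, u <+: v → v ∈ T → u ∈ T

/-! ### The sandpile model on finite subtrees -/

/-- Height configurations with heights `1, 2, 3` on the vertices of a subtree. The value `0` is
reserved for the vertices that do not belong to the subtree, so that all the subtrees share one
configuration space. -/
abbrev Config := Vertex → Fin 4

/-- Number of neighbours of `u` in `S`. -/
def numNeighbors (S : Finset Vertex) (u : Vertex) : ℕ :=
  ((S : Set Vertex) ∩ {v | binaryTree.Adj u v}).ncard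

/-- `η` is a stable configuration on `T`: heights in `{1, 2, 3}` on `T`
(and the marker `0` off `T`). -/
def IsStable (T : Finset Vertex) (η : Config) : Prop :=
  ∀ u, u ∈ T ↔ η u ≠ 0

/-- `η` contains a forbidden subconfiguration in `T`: a nonempty `S ⊆ T` such that for all `u ∈ S`
the height at `u` is at most the number of neighbours of `u` in `S`. -/
def HasFSC (T : Finset Vertex) (η : Config) : Prop :=
  ∃ S ⊆ T, S.Nonempty ∧ ∀ u ∈ S, (η u : ℕ) ≤ numNeighbors S u

/-- The set of recurrent (i.e. allowed) stable configurations on the finite tree `T`. -/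
def recurrent (T : Finset Vertex) : Set Config :=
  {η | IsStable T η ∧ ¬ HasFSC T η}

lemma finite_recurrent (T : Finset Vertex) : (recurrent T).Finite := by
  classical
  refine Set.Finite.subset (s := Set.range
    (fun (g : T → Fin 4) (u : Vertex) => if h : u ∈ T then g ⟨u, h⟩ else 0))
    (Set.finite_range _) ?_
  rintro η ⟨hη, -⟩
  refine ⟨fun u => η u, ?_⟩
  funext u
  by_cases h : u ∈ T
  · simp [h]
  · have : η u = 0 := by
      by_contra h0
      exact h ((hη u).2 h0)
    simp [h, this]

lemma recurrent_nonempty (T : Finset Vertex) : (recurrent T).Nonempty := by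
  classical
  refine ⟨fun u => if u ∈ T then 3 else 0, ?_, ?_⟩
  · intro u
    by_cases h : u ∈ T <;> simp [h]
  · rintro ⟨S, hST, hS, h⟩
    obtain ⟨u, huS, hu⟩ := S.exists_max_image List.length hS
    have h1 := h u huS
    have h2 : numNeighbors S u ≤ 1 := by
      have hsub : ((S : Set Vertex) ∩ {v | binaryTree.Adj u v}) ⊆ {u.dropLast} := by
        rintro v ⟨hvS, ⟨b, hv⟩ | ⟨b, hv⟩⟩
        · have := hu v hvS
          simp [hv] at this
        · simp [hv]
      simpa [numNeighbors] using Set.ncard_le_ncard hsub (Set.finite_singleton _)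
    have h3 : u ∈ T := hST huS
    simp only [h3, if_true] at h1
    have h4 : ((3 : Fin 4) : ℕ) = 3 := rfl
    omega

/-- The uniform measure on the recurrent configurations of the finite tree `T`. -/
def finiteSandpileMeasure (T : Finset Vertex) : ProbabilityMeasure Config :=
  ⟨uniformOn (recurrent T),
    isProbabilityMeasure_uniformOn (finite_recurrent T) (recurrent_nonempty T)⟩

/-! ### The sandpile measure of a general subtree -/

/-- Finite rooted subtrees of `T`, ordered by inclusion. -/
abbrev FiniteSubtree (T : Set Vertex) :=
  {S : Finset Vertex // IsRootedSubtree (S : Set Vertex) ∧ (S : Set Vertex) ⊆ T}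

/-- `μ` is the sandpile measure of the finite or infinite rooted subtree `T`: the weak limit of
the uniform measures on the recurrent configurations of `T'`, along the net of finite
subtrees `T' ↑ T`. If `T` is finite, then this is the uniform measure on its recurrent
configurations. -/
def IsSandpileMeasure (T : Set Vertex) (μ : ProbabilityMeasure Config) : Prop :=
  Tendsto (fun T' : FiniteSubtree T => finiteSandpileMeasure T'.1) atTop (𝓝 μ)

/-- Covariance of the heights at `u` and `v` under `μ`. -/
def heightCov (μ : ProbabilityMeasure Config) (u v : Vertex) : ℝ :=
  covariance (fun η : Config => ((η u : ℕ) : ℝ)) (fun η : Config => ((η v : ℕ) : ℝ))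
    (μ : Measure Config)

/-! ### The characteristic ratio of a finite rooted tree -/

/-- Extension of a finite rooted tree by one vertex attached to its root by an edge. In this copy
the new vertex is `[]` and a vertex `u` of the old tree becomes `false :: u`. -/
def extendTree (T : Finset Vertex) : Finset Vertex :=
  insert [] (T.map ⟨List.cons false, List.cons_injective⟩)

/-- Extension of a configuration on a finite rooted tree by height `1` at the new vertex. -/
def extendConfig (η : Config) : Config
  | [] => 1
  | false :: u => η u
  | true :: _ => 0

/-- Strongly allowed configurations: allowed, and without forbidden subconfiguration after a
vertex of height `1` has been attached to the root. -/
def stronglyAllowed (T : Finset Vertex) : Set Config :=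
  {η ∈ recurrent T | ¬ HasFSC (extendTree T) (extendConfig η)}

/-- Weakly allowed configurations: allowed, but not strongly allowed. -/
def weaklyAllowed (T : Finset Vertex) : Set Config :=
  {η ∈ recurrent T | HasFSC (extendTree T) (extendConfig η)}

/-- The characteristic ratio `x(T)`: the number of weakly allowed configurations over the number
of strongly allowed ones. -/
def charRatio (T : Finset Vertex) : ℝ :=
  ((weaklyAllowed T).ncard : ℝ) / ((stronglyAllowed T).ncard : ℝ)

/-! ### The random binary tree -/

/-- `ω u` says whether the individual `u`, if it is ever born, has two children or none. -/
abbrev Branching := Vertex → Bool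

/-- The individuals branch independently, each one with probability `p`. -/
def branchingMeasure (p : unitInterval) : Measure Branching :=
  Measure.infinitePi (fun _ : Vertex => bernoulliMeasure true false p)

instance (p : unitInterval) : IsProbabilityMeasure (branchingMeasure p) := by
  unfold branchingMeasure
  infer_instance

/-- The tree of the binary branching process: `v` belongs to it if and only if all its strict
ancestors branch. -/
def randomTree (ω : Branching) : Set Vertex :=
  {v | ∀ u : Vertex, u <+: v → u ≠ v → ω u = true}

/-- The random binary tree of `N` generations (generation `0` is the root). -/
def randomTreeUpTo (N : ℕ) (ω : Branching) : Finset Vertex :=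
  ((List.finite_length_le Bool N).subset
    (Set.inter_subset_right (s := randomTree ω) (t := {u : Vertex | u.length ≤ N}))).toFinset

/-- The law of the random binary tree conditioned on containing the vertex `v`, hence
the path from the root to `v`. -/
def conditionedMeasure (p : unitInterval) (v : Vertex) : Measure Branching :=
  cond (branchingMeasure p) {ω | v ∈ randomTree ω}

/-- The annealed absolute covariance of the heights at the root and at `v`, when
`μ T` is the sandpile measure of the tree `T`. -/
def annealedAbsCov (p : unitInterval) (μ : Set Vertex → ProbabilityMeasure Config)
    (v : Vertex) : ℝ :=
  ∫ ω, |heightCov (μ (randomTree ω)) [] v| ∂(conditionedMeasure p v)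

/-! ### The rate -/

/-- The largest eigenvalue of the matrix with rows `(γ, γ)` and `(1, 1 + γ)`. -/
def LambdaPlus (γ : ℝ) : ℝ := (2 * γ + 1 + √(4 * γ + 1)) / 2

/-- The smallest eigenvalue of the matrix with rows `(γ, γ)` and `(1, 1 + γ)`. -/
def LambdaMinus (γ : ℝ) : ℝ := (2 * γ + 1 - √(4 * γ + 1)) / 2

/-- The number `γ` with `γ⁻¹ = E((1 + x₁)⁻¹)`, where `x₁` has law `ν`. -/
def gammaOf (ν : Measure ℝ) : ℝ := (∫ x, (1 + x)⁻¹ ∂ν)⁻¹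

end TreeSandpile

end

/-! A set `S` that contains the root restricts to a forbidden set with one extra neighbour on each
branch whose root it meets. So in an allowed configuration the root height exceeds the number of
weak branches, and it is strong exactly when it does so by at least two (`hasFSCAt_iff`). Hence the
(strong, weak) sums of every product observable obey a bilinear recursion over the two branches
(`strongSum_succ`, `weakSum_succ`), and the characteristic ratio obeys `x = (1 + y)(1 + z) / (2 + y
+ z)`. This map is increasing and preserves `[0, 1]`, so ratios converge along every exhaustion; so
do the means of product observables, which determine the measure, and compactness gives the sandpile
measure (`exists_isSandpileMeasure`).

Along the path to `v`, an off-path branch of ratio `x` acts linearly on the (strong, weak) pair of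
the on-path branch. After division by `1 + x` the matrix is `N` with rows `(1 + θ, θ)` and `(1, 1)`,
where `θ = (1 + x)⁻¹`; its determinant is one. A covariance is a 2 × 2 determinant over the square
of a partition sum, so `|Cov|` is, up to bounded factors, the inverse square of the sum of the
entries of a product of such matrices (`heightCov_eq`, `pathKernel_cons`).

Conditionally on `v` being in the random tree, the off-path branches are independent copies of the
tree, so the `θ`'s are i.i.d. with the law of `(1 + x₁)⁻¹`. Thus `E|Cov|` is comparable with `E
Qₙ⁻²`, where `Qₙ` is the sum of the entries of a product of i.i.d. matrices (`kernelMoment_bounds`,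
`covMoment_bounds`, `annealedAbsCov_bounds`). The sum of entries is submultiplicative, so Fekete's
lemma gives the limit (`exists_rate`). Jensen's inequality for `t ↦ t⁻²` bounds the rate by `2 log
l`, with `l` the top eigenvalue of `E N` (`le_matrixMoment`), and `l² = Λ₊(γ)/Λ₋(γ)`. Finally `x₁ ≥
1/2` gives `E θ ≤ 2/3`, where the eigenvalue equals `(4 + √7)/3`. -/

noncomputable section

namespace TreeSandpile

/-! ### Forbidden subconfigurations and the recursive structure of the tree -/

/-- Sets of vertices that contain, with every vertex, all its ancestors. -/
def PrefixClosed (T : Set Vertex) : Prop := ∀ u v : Vertex, u <+: v → v ∈ T → u ∈ T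

/-- The subtree that hangs off the child `[b]` of the root. -/
def branch (b : Bool) (T : Set Vertex) : Set Vertex := {u | b :: u ∈ T}

/-- The finite subtree that hangs off the child `[b]` of the root. -/
def finBranch (b : Bool) (T : Finset Vertex) : Finset Vertex :=
  T.preimage (List.cons b) (List.cons_injective.injOn)

@[simp] lemma mem_branch {b : Bool} {T : Set Vertex} {u : Vertex} :
    u ∈ branch b T ↔ b :: u ∈ T := Iff.rfl

@[simp] lemma mem_finBranch {b : Bool} {T : Finset Vertex} {u : Vertex} :
    u ∈ finBranch b T ↔ b :: u ∈ T := by simp [finBranch]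

lemma coe_finBranch (b : Bool) (T : Finset Vertex) :
    (finBranch b T : Set Vertex) = branch b (T : Set Vertex) := by
  ext u; simp

lemma PrefixClosed.branch {T : Set Vertex} (h : PrefixClosed T) (b : Bool) :
    PrefixClosed (branch b T) := fun u v huv hv =>
  h (b :: u) (b :: v) (by simpa using huv) hv

lemma PrefixClosed.finBranch {T : Finset Vertex} (h : PrefixClosed (T : Set Vertex)) (b : Bool) :
    PrefixClosed (finBranch b T : Set Vertex) := by
  rw [coe_finBranch]; exact h.branch b

lemma PrefixClosed.eq_empty {T : Set Vertex} (h : PrefixClosed T) (h0 : [] ∉ T) : T = ∅ :=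
  Set.eq_empty_of_forall_notMem fun v hv => h0 (h [] v List.nil_prefix hv)

lemma PrefixClosed.finset_eq_empty {T : Finset Vertex} (h : PrefixClosed (T : Set Vertex))
    (h0 : [] ∉ T) : T = ∅ := by
  simpa using h.eq_empty (by simpa using h0)

lemma card_finBranch_lt {T : Finset Vertex} (h0 : [] ∈ T) (b : Bool) :
    (finBranch b T).card < T.card := by
  classical
  have h1 : (finBranch b T).map ⟨List.cons b, List.cons_injective⟩ ⊆ T.erase [] := by
    intro u hu
    simp only [Finset.mem_map, mem_finBranch, Function.Embedding.coeFn_mk] at hu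
    obtain ⟨w, hw, rfl⟩ := hu
    simpa using hw
  have h2 := Finset.card_le_card h1
  rw [Finset.card_map, Finset.card_erase_of_mem h0] at h2
  have := Finset.card_pos.2 ⟨_, h0⟩
  omega

/-- Induction over finite rooted trees (or the empty tree). -/
lemma tree_induction {P : Finset Vertex → Prop} (hempty : P ∅)
    (hnode : ∀ T : Finset Vertex, PrefixClosed (T : Set Vertex) → [] ∈ T →
      (∀ b, P (finBranch b T)) → P T)
    (T : Finset Vertex) (hT : PrefixClosed (T : Set Vertex)) : P T := by
  induction hn : T.card using Nat.strong_induction_on generalizing T with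
  | _ n ih =>
    by_cases h0 : [] ∈ T
    · exact hnode T hT h0 fun b =>
        ih _ (hn ▸ card_finBranch_lt h0 b) _ (hT.finBranch b) rfl
    · rw [hT.finset_eq_empty h0]; exact hempty

open Classical in
lemma numNeighbors_eq (S : Finset Vertex) (u : Vertex) :
    numNeighbors S u = (if u ++ [false] ∈ S then 1 else 0) + (if u ++ [true] ∈ S then 1 else 0) +
      (if u ≠ [] ∧ u.dropLast ∈ S then 1 else 0) := by
  have h : ((S : Set Vertex) ∩ {v | binaryTree.Adj u v}) =
      (((if u ++ [false] ∈ S then {u ++ [false]} else ∅) ∪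
        (if u ++ [true] ∈ S then {u ++ [true]} else ∅)) ∪
        (if u ≠ [] ∧ u.dropLast ∈ S then {u.dropLast} else ∅) : Finset Vertex) := by
    ext v
    simp only [binaryTree, Set.mem_inter_iff, Finset.mem_coe, Set.mem_ofPred_eq, Finset.mem_union]
    constructor
    · rintro ⟨hv, ⟨b, rfl⟩ | ⟨b, rfl⟩⟩
      · cases b <;> simp [hv]
      · simp [hv]
    · rintro ((h | h) | h)
      · split_ifs at h with h1 <;> simp at h
        subst h; exact ⟨h1, Or.inl ⟨_, rfl⟩⟩
      · split_ifs at h with h1 <;> simp at h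
        subst h; exact ⟨h1, Or.inl ⟨_, rfl⟩⟩
      · split_ifs at h with h1 <;> simp at h
        subst h
        exact ⟨h1.2, Or.inr ⟨u.getLast h1.1, (List.dropLast_append_getLast h1.1).symm⟩⟩
  rw [numNeighbors, h, Set.ncard_coe_finset, Finset.card_union_of_disjoint,
    Finset.card_union_of_disjoint]
  · congr 1
    · congr 1 <;> split_ifs <;> simp
    · split_ifs <;> simp
  · split_ifs <;> simp
  · have key : ∀ b, u ++ [b] ≠ u.dropLast := fun b h => by
      have := congrArg List.length h
      simp at this
      omega
    split_ifs <;> simp [key, fun b => (key b).symm]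

open Classical in
lemma numNeighbors_nil (S : Finset Vertex) :
    numNeighbors S [] = (if [] ∈ finBranch false S then 1 else 0) +
      (if [] ∈ finBranch true S then 1 else 0) := by
  simp [numNeighbors_eq]

open Classical in
lemma numNeighbors_cons (S : Finset Vertex) (b : Bool) (u : Vertex) :
    numNeighbors S (b :: u) = numNeighbors (finBranch b S) u +
      (if u = [] ∧ [] ∈ S then 1 else 0) := by
  rcases u with _ | ⟨a, u⟩
  · simp [numNeighbors_eq]
  · simp [numNeighbors_eq]

/-- Forbidden subconfigurations in the presence of `c` further neighbours of the root. -/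
def HasFSCAt (c : ℕ) (T : Finset Vertex) (η : Config) : Prop :=
  ∃ S ⊆ T, S.Nonempty ∧ ∀ u ∈ S, (η u : ℕ) ≤ numNeighbors S u + if u = [] then c else 0

lemma hasFSCAt_zero (T : Finset Vertex) (η : Config) : HasFSCAt 0 T η ↔ HasFSC T η := by
  simp [HasFSCAt, HasFSC]

lemma HasFSCAt.mono {c d : ℕ} (hcd : c ≤ d) {T : Finset Vertex} {η : Config}
    (h : HasFSCAt c T η) : HasFSCAt d T η := by
  obtain ⟨S, hS, hne, h⟩ := h
  refine ⟨S, hS, hne, fun u hu => (h u hu).trans ?_⟩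
  split_ifs <;> omega

lemma not_hasFSCAt_empty (c : ℕ) (η : Config) : ¬ HasFSCAt c ∅ η := by
  rintro ⟨S, hS, hne, -⟩
  exact hne.ne_empty (Finset.subset_empty.1 hS)

/-- The configuration on the subtree that hangs off the child `[b]`. -/
def tailConfig (b : Bool) (η : Config) : Config := fun u => η (b :: u)

/-- Embedding the set below `[b]` does not change neighbour counts, since the root stays outside it;
the extra neighbours of the root are therefore irrelevant. -/
lemma HasFSCAt.of_branch {T : Finset Vertex} {η : Config} {b : Bool}
    (h : HasFSCAt 0 (finBranch b T) (tailConfig b η)) (c : ℕ) : HasFSCAt c T η := by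
  obtain ⟨S, hS, ⟨w, hw⟩, h⟩ := h
  refine ⟨S.map ⟨List.cons b, List.cons_injective⟩, ?_, ⟨b :: w, by simpa using hw⟩, ?_⟩
  · intro u hu
    simp only [Finset.mem_map, Function.Embedding.coeFn_mk] at hu
    obtain ⟨w, hw, rfl⟩ := hu
    simpa using hS hw
  · intro u hu
    simp only [Finset.mem_map, Function.Embedding.coeFn_mk] at hu
    obtain ⟨w, hw, rfl⟩ := hu
    have h1 : finBranch b (S.map ⟨List.cons b, List.cons_injective⟩) = S := by
      ext u; simp
    rw [numNeighbors_cons, h1]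
    have := h w hw
    simp only [tailConfig, ite_self, add_zero] at this
    omega

open Classical in
/-- Recursive description of forbidden subconfigurations. -/
lemma hasFSCAt_iff {c : ℕ} {T : Finset Vertex} {η : Config} (hT : [] ∈ T) :
    HasFSCAt c T η ↔ HasFSCAt 0 (finBranch false T) (tailConfig false η) ∨
      HasFSCAt 0 (finBranch true T) (tailConfig true η) ∨
      (η [] : ℕ) ≤ c + (if HasFSCAt 1 (finBranch false T) (tailConfig false η) then 1 else 0) +
        (if HasFSCAt 1 (finBranch true T) (tailConfig true η) then 1 else 0) := by
  constructor
  · rintro ⟨S, hS, ⟨w, hw⟩, h⟩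
    have hsub : ∀ b, finBranch b S ⊆ finBranch b T := fun b u hu => by
      simpa using hS (by simpa using hu)
    -- If the root is in `S`, it serves as the one extra neighbour of each trace. If not, any
    -- nonempty trace is forbidden on its own.
    by_cases h0 : [] ∈ S
    · right; right
      have h1 := h [] h0
      have h2 : ∀ b, [] ∈ finBranch b S → HasFSCAt 1 (finBranch b T) (tailConfig b η) := by
        intro b hb
        refine ⟨finBranch b S, hsub b, ⟨[], hb⟩, fun u hu => ?_⟩
        have := h (b :: u) (by simpa using hu)
        rw [numNeighbors_cons] at this
        simp only [reduceCtorEq, if_false, h0, and_true, add_zero] at this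
        exact this
      rw [numNeighbors_nil] at h1
      have h3 := h2 false
      have h4 := h2 true
      split_ifs at h1 ⊢ <;> first | omega | simp_all
    · have h2 : ∀ b, (finBranch b S).Nonempty →
          HasFSCAt 0 (finBranch b T) (tailConfig b η) := by
        intro b hb
        refine ⟨finBranch b S, hsub b, hb, fun u hu => ?_⟩
        have := h (b :: u) (by simpa using hu)
        rw [numNeighbors_cons] at this
        simpa [h0, tailConfig] using this
      rcases w with _ | ⟨b, w⟩
      · exact absurd hw h0
      · cases b
        · exact Or.inl (h2 _ ⟨w, by simpa using hw⟩)
        · exact Or.inr (Or.inl (h2 _ ⟨w, by simpa using hw⟩))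
  · intro h
    by_cases hf : HasFSCAt 0 (finBranch false T) (tailConfig false η)
    · exact hf.of_branch c
    by_cases ht : HasFSCAt 0 (finBranch true T) (tailConfig true η)
    · exact ht.of_branch c
    have h1 := (h.resolve_left hf).resolve_left ht
    have hno : ∀ b, ¬ HasFSCAt 0 (finBranch b T) (tailConfig b η) := by
      intro b; cases b <;> assumption
    -- A forbidden set that needs the extra neighbour must contain the root of its branch, since
    -- otherwise it would be forbidden without it. Joining these sets to the root of `T` gives the
    -- required set.
    have key : ∀ b, ∃ R ⊆ finBranch b T,
        (∀ u ∈ R, (tailConfig b η u : ℕ) ≤ numNeighbors R u + if u = [] then 1 else 0) ∧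
        (HasFSCAt 1 (finBranch b T) (tailConfig b η) → [] ∈ R) := by
      intro b
      by_cases hb : HasFSCAt 1 (finBranch b T) (tailConfig b η)
      · obtain ⟨R, hR, hne, hR'⟩ := hb
        refine ⟨R, hR, hR', fun _ => ?_⟩
        by_contra h0
        refine hno b ⟨R, hR, hne, fun u hu => (hR' u hu).trans ?_⟩
        have : u ≠ [] := by rintro rfl; exact h0 hu
        simp [this]
      · exact ⟨∅, by simp, by simp, fun h => absurd h hb⟩
    choose R hRT hR hR0 using key
    let S : Finset Vertex := insert [] ((R false).map ⟨List.cons false, List.cons_injective⟩ ∪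
      (R true).map ⟨List.cons true, List.cons_injective⟩)
    have hS : ∀ b, finBranch b S = R b := by
      intro b; ext u; cases b <;> simp [S]
    refine ⟨S, ?_, ⟨[], by simp [S]⟩, ?_⟩
    · intro u hu
      rcases u with _ | ⟨b, u⟩
      · exact hT
      · have : u ∈ R b := by rw [← hS b]; simpa using hu
        simpa using hRT b this
    · intro u hu
      rcases u with _ | ⟨b, u⟩
      · rw [numNeighbors_nil, hS, hS]
        have h3 := hR0 false
        have h4 := hR0 true
        refine h1.trans ?_
        simp only [if_true]
        split_ifs <;> first | omega | simp_all
      · rw [numNeighbors_cons, hS]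
        have : u ∈ R b := by rw [← hS b]; simpa using hu
        have h5 := hR b u this
        simpa [S, tailConfig] using h5

/-- The recursion is applied to the extended tree, whose only nonempty branch is `T`: a vertex of
height 1 can be in a forbidden set as soon as one neighbour is, so it acts as one extra neighbour of
the root of `T`. -/
lemma hasFSC_extend_iff (T : Finset Vertex) (η : Config) :
    HasFSC (extendTree T) (extendConfig η) ↔ HasFSCAt 1 T η := by
  classical
  rw [← hasFSCAt_zero, hasFSCAt_iff (by simp [extendTree])]
  have h1 : finBranch false (extendTree T) = T := by ext u; simp [extendTree]
  have h2 : finBranch true (extendTree T) = ∅ := by ext u; simp [extendTree]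
  have h3 : tailConfig false (extendConfig η) = η := by ext u; simp [tailConfig, extendConfig]
  rw [h1, h2, h3]
  simp only [not_hasFSCAt_empty, if_false, false_or, add_zero, zero_add]
  have h4 : ((extendConfig η [] : Fin 4) : ℕ) = 1 := rfl
  rw [h4]
  constructor
  · rintro (h | h)
    · exact h.mono zero_le_one
    · by_contra h'
      simp [h'] at h
  · intro h; right; simp [h]

lemma mem_stronglyAllowed {T : Finset Vertex} {η : Config} :
    η ∈ stronglyAllowed T ↔ IsStable T η ∧ ¬ HasFSCAt 1 T η := by
  rw [← hasFSC_extend_iff]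
  change (IsStable T η ∧ ¬ HasFSC T η) ∧ ¬ HasFSC (extendTree T) (extendConfig η) ↔ _
  rw [hasFSC_extend_iff, ← hasFSCAt_zero]
  exact ⟨fun h => ⟨h.1.1, h.2⟩, fun h => ⟨⟨h.1, fun h' => h.2 (h'.mono zero_le_one)⟩, h.2⟩⟩

lemma mem_weaklyAllowed {T : Finset Vertex} {η : Config} :
    η ∈ weaklyAllowed T ↔ IsStable T η ∧ ¬ HasFSCAt 0 T η ∧ HasFSCAt 1 T η := by
  rw [← hasFSC_extend_iff, hasFSCAt_zero]
  change (IsStable T η ∧ ¬ HasFSC T η) ∧ HasFSC (extendTree T) (extendConfig η) ↔ _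
  tauto

/-! ### Sums over configurations -/

lemma finite_stable (T : Finset Vertex) : {η | IsStable T η}.Finite := by
  classical
  refine Set.Finite.subset (s := Set.range
    (fun (g : T → Fin 4) (u : Vertex) => if h : u ∈ T then g ⟨u, h⟩ else 0))
    (Set.finite_range _) ?_
  intro η hη
  refine ⟨fun u => η u, ?_⟩
  funext u
  by_cases h : u ∈ T
  · simp [h]
  · have : η u = 0 := by
      by_contra h0
      exact h ((hη u).2 h0)
    simp [h, this]

/-- The stable configurations. -/
def stableConfigs (T : Finset Vertex) : Finset Config := (finite_stable T).toFinset

@[simp] lemma mem_stableConfigs {T : Finset Vertex} {η : Config} :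
    η ∈ stableConfigs T ↔ IsStable T η := by simp [stableConfigs]

/-- The configuration with height `h` at the root and given configurations on the branches. -/
def joinConfig (h : Fin 4) (η₀ η₁ : Config) : Config
  | [] => h
  | false :: u => η₀ u
  | true :: u => η₁ u

lemma sum_stableConfigs {T : Finset Vertex} (hT : [] ∈ T) (F : Config → ℝ) :
    ∑ η ∈ stableConfigs T, F η = ∑ h ∈ ({1, 2, 3} : Finset (Fin 4)),
      ∑ η₀ ∈ stableConfigs (finBranch false T), ∑ η₁ ∈ stableConfigs (finBranch true T),
        F (joinConfig h η₀ η₁) := by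
  simp only [← Finset.sum_product']
  symm
  refine Finset.sum_nbij' (fun x => joinConfig x.1 x.2.1 x.2.2)
    (fun η => (η [], tailConfig false η, tailConfig true η)) ?_ ?_ ?_ ?_ ?_
  · rintro ⟨h, η₀, η₁⟩ hx
    simp only [Finset.mem_product, mem_stableConfigs] at hx ⊢
    intro u
    rcases u with _ | ⟨_ | _, u⟩
    · have : h ≠ 0 := by
        rintro rfl
        simp at hx
      simp [hT, joinConfig, this]
    · rw [← mem_finBranch]; exact hx.2.1 u
    · rw [← mem_finBranch]; exact hx.2.2 u
  · intro η hη
    simp only [Finset.mem_product, mem_stableConfigs] at hη ⊢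
    refine ⟨?_, fun u => ?_, fun u => ?_⟩
    · have := (hη []).1 hT
      revert this
      generalize η [] = a
      revert a; decide
    · simpa [tailConfig] using hη (false :: u)
    · simpa [tailConfig] using hη (true :: u)
  · rintro ⟨h, η₀, η₁⟩ -
    rfl
  · intro η _
    funext u
    rcases u with _ | ⟨_ | _, u⟩ <;> rfl
  · rintro ⟨h, η₀, η₁⟩ -
    rfl

lemma stableConfigs_empty : stableConfigs ∅ = {0} := by
  ext η
  simp only [mem_stableConfigs, Finset.mem_singleton]
  constructor
  · intro h; funext u
    by_contra h0
    simpa using (h u).2 h0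
  · rintro rfl u
    simp

/-- Restriction to a branch of a family of functions indexed by the vertices. -/
def shift (b : Bool) (f : Vertex → Fin 4 → ℝ) : Vertex → Fin 4 → ℝ := fun u => f (b :: u)

/-- The product observable `∏_{|u| < n} f u (η u)`. -/
def obs : ℕ → (Vertex → Fin 4 → ℝ) → Config → ℝ
  | 0, _, _ => 1
  | n + 1, f, η => f [] (η []) * obs n (shift false f) (tailConfig false η) *
      obs n (shift true f) (tailConfig true η)

open Classical in
/-- Sum of a product observable over the strongly allowed configurations. -/
def strongSum (n : ℕ) (f : Vertex → Fin 4 → ℝ) (T : Finset Vertex) : ℝ :=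
  ∑ η ∈ stableConfigs T, if ¬ HasFSCAt 1 T η then obs n f η else 0

open Classical in
/-- Sum of a product observable over the weakly allowed configurations. -/
def weakSum (n : ℕ) (f : Vertex → Fin 4 → ℝ) (T : Finset Vertex) : ℝ :=
  ∑ η ∈ stableConfigs T, if ¬ HasFSCAt 0 T η ∧ HasFSCAt 1 T η then obs n f η else 0

lemma strongSum_empty (n : ℕ) (f : Vertex → Fin 4 → ℝ) : strongSum n f ∅ = obs n f 0 := by
  simp [strongSum, stableConfigs_empty, not_hasFSCAt_empty]

lemma weakSum_empty (n : ℕ) (f : Vertex → Fin 4 → ℝ) : weakSum n f ∅ = 0 := by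
  simp [weakSum, stableConfigs_empty, not_hasFSCAt_empty]

lemma tailConfig_join_false (h : Fin 4) (η₀ η₁ : Config) :
    tailConfig false (joinConfig h η₀ η₁) = η₀ := rfl

lemma tailConfig_join_true (h : Fin 4) (η₀ η₁ : Config) :
    tailConfig true (joinConfig h η₀ η₁) = η₁ := rfl

/-- Here `a`, `c` stand for the strong and `b`, `d` for the weak terms of the two branches; `x`,
`y`, `z` are the root weights for zero, one and two weak branches. -/
lemma sum_sum_combine (A B : Finset Config) (a b c d : Config → ℝ) (x y z : ℝ) :
    ∑ i ∈ A, ∑ j ∈ B, (a i * c j * x + (a i * d j + b i * c j) * y + b i * d j * z) =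
      (∑ i ∈ A, a i) * (∑ j ∈ B, c j) * x +
        ((∑ i ∈ A, a i) * (∑ j ∈ B, d j) + (∑ i ∈ A, b i) * (∑ j ∈ B, c j)) * y +
        (∑ i ∈ A, b i) * (∑ j ∈ B, d j) * z := by
  rw [Finset.sum_mul_sum, Finset.sum_mul_sum, Finset.sum_mul_sum, Finset.sum_mul_sum]
  simp only [Finset.sum_mul, ← Finset.sum_add_distrib]

open Classical in
-- With `k` weak branches the root height must exceed `k + 1`: heights 2 and 3 for `k = 0`, only 3
-- for `k = 1`, none for `k = 2`.
lemma strongSum_succ {T : Finset Vertex} (hT : [] ∈ T) (n : ℕ) (f : Vertex → Fin 4 → ℝ) :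
    strongSum (n + 1) f T =
      strongSum n (shift false f) (finBranch false T) *
        strongSum n (shift true f) (finBranch true T) * (f [] 2 + f [] 3) +
      (strongSum n (shift false f) (finBranch false T) *
        weakSum n (shift true f) (finBranch true T) +
       weakSum n (shift false f) (finBranch false T) *
        strongSum n (shift true f) (finBranch true T)) * f [] 3 := by
  -- The vanishing term with two weak branches is restored so that `sum_sum_combine` applies.
  rw [← add_zero (_ + _ * f [] 3), ← mul_zero (weakSum n (shift false f) (finBranch false T) *
    weakSum n (shift true f) (finBranch true T))]
  simp only [strongSum, weakSum]
  rw [← sum_sum_combine, sum_stableConfigs hT, Finset.sum_comm]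
  refine Finset.sum_congr rfl fun η₀ _ => ?_
  rw [Finset.sum_comm]
  refine Finset.sum_congr rfl fun η₁ _ => ?_
  have e1 := @HasFSCAt.mono 0 1 zero_le_one (finBranch false T) η₀
  have e2 := @HasFSCAt.mono 0 1 zero_le_one (finBranch true T) η₁
  have v1 : ((1 : Fin 4) : ℕ) = 1 := rfl
  have v2 : ((2 : Fin 4) : ℕ) = 2 := rfl
  have v3 : ((3 : Fin 4) : ℕ) = 3 := rfl
  simp only [hasFSCAt_iff hT, tailConfig_join_false, tailConfig_join_true, obs]
  rw [Finset.sum_insert (by decide), Finset.sum_insert (by decide), Finset.sum_singleton]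
  simp only [joinConfig, v1, v2, v3]
  by_cases a1 : HasFSCAt 0 (finBranch false T) η₀ <;>
  by_cases a2 : HasFSCAt 0 (finBranch true T) η₁ <;>
  by_cases a3 : HasFSCAt 1 (finBranch false T) η₀ <;>
  by_cases a4 : HasFSCAt 1 (finBranch true T) η₁ <;>
  simp [a1, a2, a3, a4] at e1 e2 ⊢ <;> ring

open Classical in
-- With `k` weak branches, the configuration is weak exactly when the root height equals `k + 1`.
lemma weakSum_succ {T : Finset Vertex} (hT : [] ∈ T) (n : ℕ) (f : Vertex → Fin 4 → ℝ) :
    weakSum (n + 1) f T =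
      strongSum n (shift false f) (finBranch false T) *
        strongSum n (shift true f) (finBranch true T) * f [] 1 +
      (strongSum n (shift false f) (finBranch false T) *
        weakSum n (shift true f) (finBranch true T) +
       weakSum n (shift false f) (finBranch false T) *
        strongSum n (shift true f) (finBranch true T)) * f [] 2 +
      weakSum n (shift false f) (finBranch false T) *
        weakSum n (shift true f) (finBranch true T) * f [] 3 := by
  simp only [strongSum, weakSum]
  rw [← sum_sum_combine, sum_stableConfigs hT, Finset.sum_comm]
  refine Finset.sum_congr rfl fun η₀ _ => ?_
  rw [Finset.sum_comm]
  refine Finset.sum_congr rfl fun η₁ _ => ?_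
  have e1 := @HasFSCAt.mono 0 1 zero_le_one (finBranch false T) η₀
  have e2 := @HasFSCAt.mono 0 1 zero_le_one (finBranch true T) η₁
  have v1 : ((1 : Fin 4) : ℕ) = 1 := rfl
  have v2 : ((2 : Fin 4) : ℕ) = 2 := rfl
  have v3 : ((3 : Fin 4) : ℕ) = 3 := rfl
  simp only [hasFSCAt_iff hT, tailConfig_join_false, tailConfig_join_true, obs]
  rw [Finset.sum_insert (by decide), Finset.sum_insert (by decide), Finset.sum_singleton]
  simp only [joinConfig, v1, v2, v3]
  by_cases a1 : HasFSCAt 0 (finBranch false T) η₀ <;>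
  by_cases a2 : HasFSCAt 0 (finBranch true T) η₁ <;>
  by_cases a3 : HasFSCAt 1 (finBranch false T) η₀ <;>
  by_cases a4 : HasFSCAt 1 (finBranch true T) η₁ <;>
  simp [a1, a2, a3, a4] at e1 e2 ⊢ <;> ring

@[simp] lemma obs_one (n : ℕ) (η : Config) : obs n (fun _ _ => 1) η = 1 := by
  induction n generalizing η with
  | zero => rfl
  | succ n ih =>
    have h : ∀ b, shift b (fun _ _ => (1 : ℝ)) = fun _ _ => 1 := fun _ => rfl
    simp [obs, h, ih]

/-- Number of strongly allowed configurations. -/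
def strongCount (T : Finset Vertex) : ℝ := strongSum 0 (fun _ _ => 1) T

/-- Number of weakly allowed configurations. -/
def weakCount (T : Finset Vertex) : ℝ := weakSum 0 (fun _ _ => 1) T

lemma strongSum_one (n : ℕ) (T : Finset Vertex) :
    strongSum n (fun _ _ => 1) T = strongCount T := by
  simp [strongCount, strongSum]

lemma weakSum_one (n : ℕ) (T : Finset Vertex) :
    weakSum n (fun _ _ => 1) T = weakCount T := by
  simp [weakCount, weakSum]

lemma strongSum_zero (f : Vertex → Fin 4 → ℝ) (T : Finset Vertex) :
    strongSum 0 f T = strongCount T := rfl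

lemma weakSum_zero (f : Vertex → Fin 4 → ℝ) (T : Finset Vertex) :
    weakSum 0 f T = weakCount T := rfl

lemma strongCount_node {T : Finset Vertex} (hT : [] ∈ T) : strongCount T =
    2 * (strongCount (finBranch false T) * strongCount (finBranch true T)) +
      (strongCount (finBranch false T) * weakCount (finBranch true T) +
       weakCount (finBranch false T) * strongCount (finBranch true T)) := by
  rw [← strongSum_one 1, strongSum_succ hT]
  simp only [strongSum_zero, weakSum_zero]
  ring

lemma weakCount_node {T : Finset Vertex} (hT : [] ∈ T) : weakCount T =
    (strongCount (finBranch false T) + weakCount (finBranch false T)) *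
      (strongCount (finBranch true T) + weakCount (finBranch true T)) := by
  rw [← weakSum_one 1, weakSum_succ hT]
  simp only [strongSum_zero, weakSum_zero]
  ring

lemma weakCount_nonneg (T : Finset Vertex) : 0 ≤ weakCount T := by
  refine Finset.sum_nonneg fun η _ => ?_
  split_ifs <;> simp [obs]

lemma strongCount_empty : strongCount ∅ = 1 := by simp [strongCount, strongSum_empty]

lemma weakCount_empty : weakCount ∅ = 0 := by simp [weakCount, weakSum_empty]

lemma strongCount_pos {T : Finset Vertex} (hT : PrefixClosed (T : Set Vertex)) :
    0 < strongCount T := by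
  refine tree_induction (P := fun T => 0 < strongCount T) ?_ ?_ T hT
  · simp [strongCount_empty]
  · intro T _ h0 ih
    rw [strongCount_node h0]
    have := ih false
    have := ih true
    have := weakCount_nonneg (finBranch false T)
    have := weakCount_nonneg (finBranch true T)
    positivity

lemma charRatio_eq (T : Finset Vertex) : charRatio T = weakCount T / strongCount T := by
  classical
  have h1 : stronglyAllowed T =
      ((stableConfigs T).filter (fun η => ¬ HasFSCAt 1 T η) : Finset Config) := by
    ext η; simp [mem_stronglyAllowed]
  have h2 : weaklyAllowed T =
      ((stableConfigs T).filter (fun η => ¬ HasFSCAt 0 T η ∧ HasFSCAt 1 T η) :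
        Finset Config) := by
    ext η; simp [mem_weaklyAllowed]
  rw [charRatio, h1, h2, Set.ncard_coe_finset, Set.ncard_coe_finset, Finset.card_filter,
    Finset.card_filter]
  simp only [weakCount, strongCount, weakSum, strongSum, obs]
  push_cast
  rfl

/-! ### The characteristic ratio of general subtrees -/

open Classical in
/-- The characteristic ratio of the tree `T` restricted to the vertices with `u.length < n`. -/
def ratio : ℕ → Set Vertex → ℝ
  | 0, _ => 0
  | n + 1, T => if [] ∈ T then (1 + ratio n (branch false T)) * (1 + ratio n (branch true T)) /
      (2 + ratio n (branch false T) + ratio n (branch true T)) else 0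

/-- The map is the reciprocal of `(1 + a)⁻¹ + (1 + c)⁻¹`, hence increasing in both arguments. -/
lemma ratioMap_mono {a b c d : ℝ} (ha : 0 ≤ a) (hc : 0 ≤ c) (hab : a ≤ b) (hcd : c ≤ d) :
    (1 + a) * (1 + c) / (2 + a + c) ≤ (1 + b) * (1 + d) / (2 + b + d) := by
  rw [div_le_div_iff₀ (by linarith) (by linarith)]
  have h1 : (1 + a) * (1 + c) * (1 + b) ≤ (1 + b) * (1 + d) * (1 + a) := by
    have : (1 + a) * (1 + b) * (1 + c) ≤ (1 + a) * (1 + b) * (1 + d) :=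
      mul_le_mul_of_nonneg_left (by linarith) (by nlinarith)
    linarith
  have h2 : (1 + a) * (1 + c) * (1 + d) ≤ (1 + b) * (1 + d) * (1 + c) := by
    have : (1 + c) * (1 + d) * (1 + a) ≤ (1 + c) * (1 + d) * (1 + b) :=
      mul_le_mul_of_nonneg_left (by linarith) (by nlinarith)
    linarith
  nlinarith

lemma ratioMap_le_one {a c : ℝ} (ha : 0 ≤ a) (hc : 0 ≤ c) (ha1 : a ≤ 1) (hc1 : c ≤ 1) :
    (1 + a) * (1 + c) / (2 + a + c) ≤ 1 := by
  have := ratioMap_mono ha hc ha1 hc1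
  norm_num at this
  exact this

lemma half_le_ratioMap {a c : ℝ} (ha : 0 ≤ a) (hc : 0 ≤ c) :
    1 / 2 ≤ (1 + a) * (1 + c) / (2 + a + c) := by
  have := ratioMap_mono le_rfl le_rfl ha hc
  norm_num at this ⊢
  exact this

lemma ratio_mem (n : ℕ) (T : Set Vertex) : 0 ≤ ratio n T ∧ ratio n T ≤ 1 := by
  induction n generalizing T with
  | zero => simp [ratio]
  | succ n ih =>
    rw [ratio]
    split_ifs
    · have h0 := ih (branch false T)
      have h1 := ih (branch true T)
      exact ⟨by linarith [half_le_ratioMap h0.1 h1.1], ratioMap_le_one h0.1 h1.1 h0.2 h1.2⟩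
    · simp

lemma ratio_nonneg (n : ℕ) (T : Set Vertex) : 0 ≤ ratio n T := (ratio_mem n T).1

lemma ratio_le_one (n : ℕ) (T : Set Vertex) : ratio n T ≤ 1 := (ratio_mem n T).2

lemma ratio_mono_tree {n : ℕ} {T T' : Set Vertex} (h : ∀ u ∈ T, u.length < n → u ∈ T') :
    ratio n T ≤ ratio n T' := by
  induction n generalizing T T' with
  | zero => simp [ratio]
  | succ n ih =>
    rw [ratio, ratio]
    by_cases h0 : [] ∈ T
    · rw [if_pos h0, if_pos (h _ h0 (by simp))]
      refine ratioMap_mono (ratio_nonneg _ _) (ratio_nonneg _ _) (ih ?_) (ih ?_) <;>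
      exact fun u hu hn => h _ hu (by simpa using hn)
    · rw [if_neg h0]
      exact ratio_nonneg (n + 1) T'

lemma ratio_le_succ (n : ℕ) (T : Set Vertex) : ratio n T ≤ ratio (n + 1) T := by
  induction n generalizing T with
  | zero => exact ratio_nonneg _ _
  | succ n ih =>
    rw [ratio, ratio]
    split_ifs
    · exact ratioMap_mono (ratio_nonneg _ _) (ratio_nonneg _ _) (ih _) (ih _)
    · exact le_rfl

lemma ratio_monotone (T : Set Vertex) : Monotone fun n => ratio n T :=
  monotone_nat_of_le_succ fun n => ratio_le_succ n T

/-- Dividing the recursion of the weak counts by that of the strong counts leaves a recursion in the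
ratios alone. -/
lemma charRatio_eq_ratio {n : ℕ} {T : Finset Vertex} (hT : PrefixClosed (T : Set Vertex))
    (hn : ∀ u ∈ T, u.length < n) : charRatio T = ratio n T := by
  induction n generalizing T with
  | zero =>
    have : T = ∅ := Finset.eq_empty_of_forall_notMem fun u hu => by simpa using hn u hu
    simp [this, charRatio_eq, weakCount_empty, ratio]
  | succ n ih =>
    rw [ratio]
    by_cases h0 : [] ∈ T
    · rw [if_pos (by simpa using h0), ← coe_finBranch, ← coe_finBranch]
      have key : ∀ b, ratio n (finBranch b T) =
          weakCount (finBranch b T) / strongCount (finBranch b T) := fun b => by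
        rw [← charRatio_eq, ih (hT.finBranch b)]
        intro u hu
        simpa using hn (b :: u) (by simpa using hu)
      rw [key, key, charRatio_eq, strongCount_node h0, weakCount_node h0]
      have p0 := strongCount_pos (hT.finBranch false)
      have p1 := strongCount_pos (hT.finBranch true)
      have q0 := weakCount_nonneg (finBranch false T)
      have q1 := weakCount_nonneg (finBranch true T)
      have e1 : 2 + weakCount (finBranch false T) / strongCount (finBranch false T) +
          weakCount (finBranch true T) / strongCount (finBranch true T) =
          (2 * (strongCount (finBranch false T) * strongCount (finBranch true T)) +
            (strongCount (finBranch false T) * weakCount (finBranch true T) +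
            weakCount (finBranch false T) * strongCount (finBranch true T))) /
            (strongCount (finBranch false T) * strongCount (finBranch true T)) := by
        field_simp; ring
      have e2 : 0 < (2 * (strongCount (finBranch false T) * strongCount (finBranch true T)) +
            (strongCount (finBranch false T) * weakCount (finBranch true T) +
            weakCount (finBranch false T) * strongCount (finBranch true T))) := by positivity
      rw [e1]
      field_simp
    · rw [if_neg (by simpa using h0), hT.finset_eq_empty h0]
      simp [charRatio_eq, weakCount_empty]

/-- The characteristic ratio of a finite or infinite subtree. -/
def ratioLim (T : Set Vertex) : ℝ := ⨆ n, ratio n T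

lemma tendsto_ratio (T : Set Vertex) : Tendsto (fun n => ratio n T) atTop (𝓝 (ratioLim T)) :=
  tendsto_atTop_ciSup (ratio_monotone T) ⟨1, by rintro _ ⟨n, rfl⟩; exact ratio_le_one n T⟩

lemma ratio_le_ratioLim (n : ℕ) (T : Set Vertex) : ratio n T ≤ ratioLim T :=
  le_ciSup (f := fun n => ratio n T)
    ⟨1, by rintro _ ⟨n, rfl⟩; exact ratio_le_one n T⟩ n

lemma ratioLim_nonneg (T : Set Vertex) : 0 ≤ ratioLim T :=
  (ratio_nonneg 0 T).trans (ratio_le_ratioLim 0 T)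

lemma ratioLim_le_one (T : Set Vertex) : ratioLim T ≤ 1 := ciSup_le fun n => ratio_le_one n T

lemma ratioLim_node {T : Set Vertex} (hT : [] ∈ T) : ratioLim T =
    (1 + ratioLim (branch false T)) * (1 + ratioLim (branch true T)) /
      (2 + ratioLim (branch false T) + ratioLim (branch true T)) := by
  have h0 := tendsto_ratio (branch false T)
  have h1 := tendsto_ratio (branch true T)
  have p0 := ratioLim_nonneg (branch false T)
  have p1 := ratioLim_nonneg (branch true T)
  refine tendsto_nhds_unique ((tendsto_ratio T).comp (tendsto_add_atTop_nat 1)) ?_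
  refine Tendsto.congr (fun n => ?_)
    (((h0.const_add 1).mul (h1.const_add 1)).div ((h0.const_add 2).add h1) (by linarith))
  simp [ratio, hT]

lemma ratioLim_of_notMem {T : Set Vertex} (hT : [] ∉ T) : ratioLim T = 0 := by
  have : ∀ n, ratio n T = 0 := fun n => by cases n <;> simp [ratio, hT]
  simp [ratioLim, this]

lemma half_le_ratioLim {T : Set Vertex} (hT : [] ∈ T) : 1 / 2 ≤ ratioLim T := by
  rw [ratioLim_node hT]
  exact half_le_ratioMap (ratioLim_nonneg _) (ratioLim_nonneg _)

/-! ### Existence of the sandpile measure -/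

/-- Strong partition sum at a vertex, from the (strong, weak) sums of the two branches. -/
def nodeStrong (φ : Fin 4 → ℝ) (p q : ℝ × ℝ) : ℝ :=
  p.1 * q.1 * (φ 2 + φ 3) + (p.1 * q.2 + p.2 * q.1) * φ 3

/-- Weak partition sum at a vertex, from the (strong, weak) sums of the two branches. -/
def nodeWeak (φ : Fin 4 → ℝ) (p q : ℝ × ℝ) : ℝ :=
  p.1 * q.1 * φ 1 + (p.1 * q.2 + p.2 * q.1) * φ 2 + p.2 * q.2 * φ 3

/-- The (strong, weak) sums, normalized by the number of strongly allowed configurations. -/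
def normSums (n : ℕ) (f : Vertex → Fin 4 → ℝ) (T : Finset Vertex) : ℝ × ℝ :=
  (strongSum n f T / strongCount T, weakSum n f T / strongCount T)

open Classical in
/-- The normalized (strong, weak) sums of a finite or infinite subtree. -/
def limSums : ℕ → (Vertex → Fin 4 → ℝ) → Set Vertex → ℝ × ℝ
  | 0, _, T => (1, ratioLim T)
  | n + 1, f, T => if [] ∈ T then
      (nodeStrong (f []) (limSums n (shift false f) (branch false T))
          (limSums n (shift true f) (branch true T)) /
        (2 + ratioLim (branch false T) + ratioLim (branch true T)),
       nodeWeak (f []) (limSums n (shift false f) (branch false T))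
          (limSums n (shift true f) (branch true T)) /
        (2 + ratioLim (branch false T) + ratioLim (branch true T)))
      -- The empty tree has one configuration, identically zero, and it is strongly allowed.
      else (obs (n + 1) f 0, 0)

/-- The finite trees `T' i` exhaust the tree `T` along the filter `l`. -/
structure Exhausts {ι : Type*} (l : Filter ι) (T' : ι → Finset Vertex) (T : Set Vertex) :
    Prop where
  prefixClosed : ∀ i, PrefixClosed (T' i : Set Vertex)
  subset : ∀ i, (T' i : Set Vertex) ⊆ T
  eventually_mem : ∀ u ∈ T, ∀ᶠ i in l, u ∈ T' i

lemma Exhausts.finBranch {ι : Type*} {l : Filter ι} {T' : ι → Finset Vertex} {T : Set Vertex}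
    (h : Exhausts l T' T) (b : Bool) : Exhausts l (fun i => finBranch b (T' i)) (branch b T) where
  prefixClosed i := (h.prefixClosed i).finBranch b
  subset i := fun u hu => h.subset i (by simpa using hu)
  eventually_mem u hu := by
    filter_upwards [h.eventually_mem (b :: u) hu] with i hi
    simpa using hi

/-- This allows passing to an ultrafilter that realizes a cluster point. -/
lemma Exhausts.mono {ι : Type*} {l l' : Filter ι} {T' : ι → Finset Vertex} {T : Set Vertex}
    (h : Exhausts l T' T) (hl : l' ≤ l) : Exhausts l' T' T where
  prefixClosed := h.prefixClosed
  subset := h.subset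
  eventually_mem u hu := hl (h.eventually_mem u hu)

lemma charRatio_le_ratioLim {T' : Finset Vertex} {T : Set Vertex}
    (h : PrefixClosed (T' : Set Vertex)) (hT : (T' : Set Vertex) ⊆ T) :
    charRatio T' ≤ ratioLim T := by
  have hn : ∀ u ∈ T', u.length < T'.sup List.length + 1 := fun u hu =>
    Nat.lt_succ_of_le (Finset.le_sup (f := List.length) hu)
  rw [charRatio_eq_ratio h hn]
  exact (ratio_mono_tree fun u hu _ => hT hu).trans (ratio_le_ratioLim _ _)

lemma ratio_le_charRatio {n : ℕ} {T' : Finset Vertex} {T : Set Vertex}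
    (h : PrefixClosed (T' : Set Vertex)) (hT : ∀ u ∈ T, u.length < n → u ∈ T') :
    ratio n T ≤ charRatio T' := by
  have hn : ∀ u ∈ T', u.length < max n (T'.sup List.length + 1) := fun u hu =>
    lt_max_of_lt_right (Nat.lt_succ_of_le (Finset.le_sup (f := List.length) hu))
  rw [charRatio_eq_ratio h hn]
  exact (ratio_mono_tree (T' := T') fun u hu hu' => by simpa using hT u hu hu').trans
    (ratio_monotone _ (le_max_left _ _))

/-- Monotonicity in the tree gives a squeeze: the ratio never exceeds `ratioLim T`, and it is at
least `ratio n T` once the finitely many vertices of depth below `n` are present. -/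
lemma Exhausts.tendsto_charRatio {ι : Type*} {l : Filter ι} {T' : ι → Finset Vertex}
    {T : Set Vertex} (h : Exhausts l T' T) :
    Tendsto (fun i => charRatio (T' i)) l (𝓝 (ratioLim T)) := by
  rw [tendsto_order]
  refine ⟨fun a ha => ?_, fun a ha => Eventually.of_forall fun i =>
    (charRatio_le_ratioLim (h.prefixClosed i) (h.subset i)).trans_lt ha⟩
  obtain ⟨n, hn⟩ := ((tendsto_ratio T).eventually_const_lt ha).exists
  have hfin : (T ∩ {u : Vertex | u.length < n}).Finite :=
    (List.finite_length_lt Bool n).subset Set.inter_subset_right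
  have := (Filter.eventually_all_finite hfin).2 fun u hu => h.eventually_mem u hu.1
  filter_upwards [this] with i hi
  exact hn.trans_le (ratio_le_charRatio (h.prefixClosed i) fun u hu hu' => hi u ⟨hu, hu'⟩)

lemma charRatio_nonneg (T : Finset Vertex) : 0 ≤ charRatio T := by
  unfold charRatio; positivity

lemma normSums_zero (f : Vertex → Fin 4 → ℝ) {T : Finset Vertex}
    (hT : PrefixClosed (T : Set Vertex)) : normSums 0 f T = (1, charRatio T) := by
  rw [normSums, strongSum_zero, weakSum_zero, charRatio_eq, div_self (strongCount_pos hT).ne']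

lemma strongCount_div {T : Finset Vertex} (hT : PrefixClosed (T : Set Vertex)) (h0 : [] ∈ T) :
    strongCount T = strongCount (finBranch false T) * strongCount (finBranch true T) *
      (2 + charRatio (finBranch false T) + charRatio (finBranch true T)) := by
  have p0 := strongCount_pos (hT.finBranch false)
  have p1 := strongCount_pos (hT.finBranch true)
  rw [strongCount_node h0, charRatio_eq, charRatio_eq]
  field_simp
  ring

lemma normSums_succ (n : ℕ) (f : Vertex → Fin 4 → ℝ) {T : Finset Vertex}
    (hT : PrefixClosed (T : Set Vertex)) (h0 : [] ∈ T) : normSums (n + 1) f T =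
      (nodeStrong (f []) (normSums n (shift false f) (finBranch false T))
          (normSums n (shift true f) (finBranch true T)) /
        (2 + charRatio (finBranch false T) + charRatio (finBranch true T)),
       nodeWeak (f []) (normSums n (shift false f) (finBranch false T))
          (normSums n (shift true f) (finBranch true T)) /
        (2 + charRatio (finBranch false T) + charRatio (finBranch true T))) := by
  have p0 := strongCount_pos (hT.finBranch false)
  have p1 := strongCount_pos (hT.finBranch true)
  have q0 := charRatio_nonneg (finBranch false T)
  have q1 := charRatio_nonneg (finBranch true T)
  have q : 0 < 2 + charRatio (finBranch false T) + charRatio (finBranch true T) := by positivity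
  simp only [normSums, nodeStrong, nodeWeak]
  rw [strongSum_succ h0, weakSum_succ h0, strongCount_div hT h0]
  congr 1 <;> field_simp

/-- The observable sees only `n` levels, so finitely many continuous recursion steps suffice;
everything below enters only through characteristic ratios. -/
lemma Exhausts.tendsto_normSums {ι : Type*} {l : Filter ι} {T' : ι → Finset Vertex}
    {T : Set Vertex} (h : Exhausts l T' T) (n : ℕ) (f : Vertex → Fin 4 → ℝ) :
    Tendsto (fun i => normSums n f (T' i)) l (𝓝 (limSums n f T)) := by
  induction n generalizing f T T' with
  | zero =>
    simp only [limSums, normSums_zero f (h.prefixClosed _)]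
    exact tendsto_const_nhds.prodMk_nhds h.tendsto_charRatio
  | succ n ih =>
    rw [limSums]
    by_cases h0 : [] ∈ T
    · rw [if_pos h0]
      have a := ih (h.finBranch false) (shift false f)
      have b := ih (h.finBranch true) (shift true f)
      have a1 := (continuous_fst.tendsto _).comp a
      have a2 := (continuous_snd.tendsto _).comp a
      have b1 := (continuous_fst.tendsto _).comp b
      have b2 := (continuous_snd.tendsto _).comp b
      have x := ((h.finBranch false).tendsto_charRatio.const_add 2).add
        (h.finBranch true).tendsto_charRatio
      have hne : 2 + ratioLim (branch false T) + ratioLim (branch true T) ≠ 0 := by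
        have := ratioLim_nonneg (branch false T)
        have := ratioLim_nonneg (branch true T)
        positivity
      refine Tendsto.congr' ?_ (Tendsto.prodMk_nhds
        (Tendsto.div (((a1.mul b1).mul_const (f [] 2 + f [] 3)).add
          (((a1.mul b2).add (a2.mul b1)).mul_const (f [] 3))) x hne)
        (Tendsto.div ((((a1.mul b1).mul_const (f [] 1)).add
          (((a1.mul b2).add (a2.mul b1)).mul_const (f [] 2))).add
          ((a2.mul b2).mul_const (f [] 3))) x hne))
      filter_upwards [h.eventually_mem [] h0] with i hi
      rw [normSums_succ n f (h.prefixClosed i) hi]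
      rfl
    · rw [if_neg h0]
      have : ∀ i, T' i = ∅ := fun i =>
        (h.prefixClosed i).finset_eq_empty fun h' => h0 (h.subset i h')
      simpa [this, normSums, strongSum_empty, weakSum_empty, strongCount_empty] using
        tendsto_const_nhds

/-- The limiting expectation of the observable `obs n f`. -/
def limMean (n : ℕ) (f : Vertex → Fin 4 → ℝ) (T : Set Vertex) : ℝ :=
  ((limSums n f T).1 + (limSums n f T).2) / (1 + ratioLim T)

lemma integral_obs_finite (n : ℕ) (f : Vertex → Fin 4 → ℝ) (T : Finset Vertex) :
    ∫ η, obs n f η ∂(finiteSandpileMeasure T : Measure Config) =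
      (strongSum n f T + weakSum n f T) / (strongCount T + weakCount T) := by
  classical
  have h1 : recurrent T =
      ((stableConfigs T).filter (fun η => ¬ HasFSCAt 0 T η) : Finset Config) := by
    ext η
    simp [hasFSCAt_zero, recurrent]
  have h2 : ∀ g : Config → ℝ,
      ∑ η ∈ (stableConfigs T).filter (fun η => ¬ HasFSCAt 0 T η), g η =
      (∑ η ∈ stableConfigs T, if ¬ HasFSCAt 1 T η then g η else 0) +
      ∑ η ∈ stableConfigs T, if ¬ HasFSCAt 0 T η ∧ HasFSCAt 1 T η then g η else 0 := by
    intro g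
    rw [Finset.sum_filter, ← Finset.sum_add_distrib]
    refine Finset.sum_congr rfl fun η _ => ?_
    have := @HasFSCAt.mono 0 1 zero_le_one T η
    by_cases a : HasFSCAt 0 T η <;> by_cases b : HasFSCAt 1 T η <;> simp_all
  have h3 := h2 (fun _ => 1)
  simp only [Finset.sum_const, nsmul_eq_mul, mul_one] at h3
  change ∫ η, obs n f η ∂(uniformOn (recurrent T)) = _
  rw [h1, uniformOn, ProbabilityTheory.cond, integral_smul_measure, setIntegral_finset]
  · simp only [measureReal_def, Measure.count_singleton, ENNReal.toReal_one, one_smul]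
    rw [h2, Measure.count_apply_finset, ENNReal.toReal_inv, ENNReal.toReal_natCast, h3,
      smul_eq_mul, div_eq_inv_mul]
    rfl
  · rw [← Set.biUnion_of_singleton (SetLike.coe (Finset.filter _ _))]
    exact integrableOn_finset_iUnion.2 fun η _ => integrableOn_singleton (by simp) (by simp)

lemma Exhausts.tendsto_mean {ι : Type*} {l : Filter ι} {T' : ι → Finset Vertex}
    {T : Set Vertex} (h : Exhausts l T' T) (n : ℕ) (f : Vertex → Fin 4 → ℝ) :
    Tendsto (fun i => ∫ η, obs n f η ∂(finiteSandpileMeasure (T' i) : Measure Config)) l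
      (𝓝 (limMean n f T)) := by
  have a := h.tendsto_normSums n f
  have x := h.tendsto_charRatio
  have hne : 1 + ratioLim T ≠ 0 := by
    have := ratioLim_nonneg T
    positivity
  refine Tendsto.congr (fun i => ?_) ((((continuous_fst.tendsto _).comp a).add
    ((continuous_snd.tendsto _).comp a)).div (x.const_add 1) hne)
  have p := strongCount_pos (h.prefixClosed i)
  have q := weakCount_nonneg (T' i)
  simp only [Function.comp, Pi.div_apply, normSums]
  rw [integral_obs_finite, charRatio_eq]
  field_simp

lemma continuous_obs (n : ℕ) (f : Vertex → Fin 4 → ℝ) : Continuous (obs n f) := by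
  induction n generalizing f with
  | zero => exact continuous_const
  | succ n ih =>
    have h : ∀ b, Continuous (tailConfig b) := fun b =>
      continuous_pi fun u => continuous_apply _
    have h0 : Continuous fun η : Config => f [] (η []) :=
      (continuous_of_discreteTopology (f := f [])).comp (continuous_apply ([] : Vertex))
    have h1 : ∀ b, Continuous fun η => obs n (shift b f) (tailConfig b η) := fun b =>
      (ih (shift b f)).comp (h b)
    exact (h0.mul (h1 false)).mul (h1 true)

open Classical in
lemma prod_vertices {M : Type*} [CommMonoid M] {I : Finset Vertex} (g : Vertex → M) :
    ∏ u ∈ I, g u = (if [] ∈ I then g [] else 1) * (∏ u ∈ finBranch false I, g (false :: u)) *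
      ∏ u ∈ finBranch true I, g (true :: u) := by
  have h : I = (if [] ∈ I then {[]} else ∅) ∪
      ((finBranch false I).map ⟨List.cons false, List.cons_injective⟩ ∪
        (finBranch true I).map ⟨List.cons true, List.cons_injective⟩) := by
    ext u
    rcases u with _ | ⟨_ | _, u⟩ <;> by_cases h : [] ∈ I <;> simp [h]
  conv_lhs => rw [h]
  rw [Finset.prod_union, Finset.prod_union, Finset.prod_map, Finset.prod_map, mul_assoc]
  · congr 1
    split_ifs <;> simp
  · rw [Finset.disjoint_left]
    intro u hu hu'
    simp only [Finset.mem_map, Function.Embedding.coeFn_mk] at hu hu'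
    obtain ⟨_, -, rfl⟩ := hu
    simp at hu'
  · rw [Finset.disjoint_left]
    intro u hu hu'
    split_ifs at hu <;> simp at hu
    subst hu
    simp at hu'

lemma obs_eq_prod {n : ℕ} {f : Vertex → Fin 4 → ℝ} {I : Finset Vertex}
    (hI : ∀ u ∈ I, u.length < n) (hf : ∀ u ∉ I, ∀ h, f u h = 1) (η : Config) :
    obs n f η = ∏ u ∈ I, f u (η u) := by
  classical
  induction n generalizing f I η with
  | zero =>
    have : I = ∅ := Finset.eq_empty_of_forall_notMem fun u hu => by simpa using hI u hu
    simp [this, obs]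
  | succ n ih =>
    have key : ∀ b, obs n (shift b f) (tailConfig b η) =
        ∏ u ∈ finBranch b I, f (b :: u) (η (b :: u)) := fun b =>
      ih (fun u hu => by simpa using hI (b :: u) (by simpa using hu))
        (fun u hu => hf (b :: u) (by simpa using hu)) _
    rw [obs, prod_vertices, key, key]
    split_ifs with h
    · rfl
    · rw [hf [] h]

/-- Indicators of cylinders are product observables, and the finite-dimensional marginals determine
the measure. -/
lemma ext_of_integral_obs {μ ν : Measure Config} [IsProbabilityMeasure μ]
    [IsProbabilityMeasure ν] (h : ∀ n f, ∫ η, obs n f η ∂μ = ∫ η, obs n f η ∂ν) : μ = ν := by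
  classical
  have hproj : ∀ I : Finset Vertex, ν.map I.restrict = μ.map I.restrict := by
    intro I
    refine Measure.ext_of_singleton fun ξ => ?_
    rw [Measure.map_apply (by fun_prop) (measurableSet_singleton _),
      Measure.map_apply (by fun_prop) (measurableSet_singleton _)]
    let f : Vertex → Fin 4 → ℝ := fun u h => if hu : u ∈ I then (if h = ξ ⟨u, hu⟩ then 1 else 0)
      else 1
    have hobs : obs (I.sup List.length + 1) f =
        (I.restrict ⁻¹' {ξ} : Set Config).indicator 1 := by
      funext η
      rw [obs_eq_prod (I := I) (fun u hu => Nat.lt_succ_of_le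
        (Finset.le_sup (f := List.length) hu)) (fun u hu h => by simp [f, hu]) η]
      by_cases hη : η ∈ (I.restrict ⁻¹' {ξ} : Set Config)
      · rw [Set.indicator_of_mem hη]
        refine Finset.prod_eq_one fun u hu => ?_
        have : I.restrict η = ξ := hη
        simp [f, hu, ← this]
      · rw [Set.indicator_of_notMem hη]
        have : ∃ u : I, η u ≠ ξ u := by
          by_contra! hc
          exact hη (funext hc)
        obtain ⟨u, hu⟩ := this
        exact Finset.prod_eq_zero u.2 (by simp [f, hu])
    have hm : MeasurableSet (I.restrict ⁻¹' {ξ} : Set Config) :=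
      (measurableSet_singleton _).preimage (by fun_prop)
    have := h (I.sup List.length + 1) f
    rw [hobs, integral_indicator_one hm, integral_indicator_one hm] at this
    exact ((measureReal_eq_measureReal_iff).1 this).symm
  exact IsProjectiveLimit.unique (P := fun I => μ.map I.restrict) (fun I => rfl) hproj

lemma tendsto_integral_obs {ι : Type*} {l : Filter ι} {μs : ι → ProbabilityMeasure Config}
    {μ : ProbabilityMeasure Config} (h : Tendsto μs l (𝓝 μ)) (n : ℕ)
    (f : Vertex → Fin 4 → ℝ) :
    Tendsto (fun i => ∫ η, obs n f η ∂(μs i : Measure Config)) l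
      (𝓝 (∫ η, obs n f η ∂(μ : Measure Config))) :=
  (ProbabilityMeasure.tendsto_iff_forall_integral_tendsto.1 h)
    (BoundedContinuousFunction.mkOfCompact ⟨obs n f, continuous_obs n f⟩)

lemma exhausts_finiteSubtree {T : Set Vertex} (hT : IsRootedSubtree T) :
    Exhausts (atTop : Filter (FiniteSubtree T)) (fun T' => T'.1) T where
  prefixClosed i := i.2.1.2
  subset i := i.2.2
  eventually_mem u hu := by
    have hS : IsRootedSubtree (u.inits.toFinset : Set Vertex) := by
      refine ⟨by simp, fun a b hab hb => ?_⟩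
      simp only [List.coe_toFinset, List.mem_inits, Set.mem_ofPred_eq] at hb ⊢
      exact hab.trans hb
    have hST : (u.inits.toFinset : Set Vertex) ⊆ T := by
      intro a ha
      simp only [List.coe_toFinset, List.mem_inits, Set.mem_ofPred_eq] at ha
      exact hT.2 a u ha hu
    filter_upwards [eventually_ge_atTop (⟨u.inits.toFinset, hS, hST⟩ : FiniteSubtree T)] with i hi
    exact hi (by simp)

instance (T : Set Vertex) : IsDirectedOrder (FiniteSubtree T) := by
  classical
  refine ⟨fun a b => ?_⟩
  refine ⟨⟨a.1 ∪ b.1, ⟨by simp [a.2.1.1], fun u v huv hv => ?_⟩, ?_⟩,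
    Finset.subset_union_left, Finset.subset_union_right⟩
  · simp only [Finset.coe_union, Set.mem_union] at hv ⊢
    exact hv.imp (a.2.1.2 u v huv) (b.2.1.2 u v huv)
  · simpa using ⟨a.2.2, b.2.2⟩

lemma FiniteSubtree.nonempty {T : Set Vertex} (hT : IsRootedSubtree T) :
    Nonempty (FiniteSubtree T) :=
  ⟨⟨{[]}, ⟨by simp, fun u v huv hv => by simp_all⟩, by simpa using hT.1⟩⟩

/-- The probability measures on the compact configuration space form a compact space, so cluster
points exist. Each has the means `limMean`, so there is only one, and the net converges to it. -/
lemma exists_isSandpileMeasure {T : Set Vertex} (hT : IsRootedSubtree T) :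
    ∃ μ, IsSandpileMeasure T μ := by
  have := FiniteSubtree.nonempty hT
  have key : ∀ μ : ProbabilityMeasure Config,
      MapClusterPt μ atTop (fun T' : FiniteSubtree T => finiteSandpileMeasure T'.1) →
      ∀ n f, ∫ η, obs n f η ∂(μ : Measure Config) = limMean n f T := by
    intro μ hμ n f
    obtain ⟨U, hU, hUμ⟩ := mapClusterPt_iff_ultrafilter.1 hμ
    exact tendsto_nhds_unique (tendsto_integral_obs hUμ n f)
      (((exhausts_finiteSubtree hT).mono hU).tendsto_mean n f)
  obtain ⟨μ, hμ⟩ := exists_clusterPt_of_compactSpace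
    (map (fun T' : FiniteSubtree T => finiteSandpileMeasure T'.1) atTop)
  refine ⟨μ, le_nhds_of_unique_clusterPt fun ν hν => ?_⟩
  refine Subtype.ext (ext_of_integral_obs (μ := (ν : Measure Config)) (ν := (μ : Measure Config))
    fun n f => ?_)
  rw [key μ hμ, key ν hν]

lemma IsSandpileMeasure.integral_obs {T : Set Vertex} (hT : IsRootedSubtree T)
    {μ : ProbabilityMeasure Config} (hμ : IsSandpileMeasure T μ) (n : ℕ)
    (f : Vertex → Fin 4 → ℝ) : ∫ η, obs n f η ∂(μ : Measure Config) = limMean n f T := by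
  have := FiniteSubtree.nonempty hT
  exact tendsto_nhds_unique (tendsto_integral_obs hμ n f)
    ((exhausts_finiteSubtree hT).tendsto_mean n f)

/-! ### The covariance formula -/

/-- The height as a real number. -/
def height (h : Fin 4) : ℝ := ((h : ℕ) : ℝ)

@[simp] lemma height_one : height 1 = 1 := by norm_num [height]

@[simp] lemma height_two : height 2 = 2 := by simp [height]

@[simp] lemma height_three : height 3 = 3 := by simp [height]

/-- The family of functions that equals `g` at `v` and `1` at the other vertices. -/
def marked (v : Vertex) (g : Fin 4 → ℝ) : Vertex → Fin 4 → ℝ :=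
  fun u h => open Classical in if u = v then g h else 1

lemma limSums_one (n : ℕ) (T : Set Vertex) :
    limSums n (fun _ _ => 1) T = (1, ratioLim T) := by
  induction n generalizing T with
  | zero => rfl
  | succ n ih =>
    have h : ∀ b, shift b (fun _ _ => (1 : ℝ)) = fun _ _ => 1 := fun _ => rfl
    rw [limSums, h, h, ih, ih, obs_one]
    split_ifs with h0
    · have p := ratioLim_nonneg (branch false T)
      have q := ratioLim_nonneg (branch true T)
      rw [ratioLim_node h0]
      simp only [nodeStrong, nodeWeak]
      congr 1
      · rw [div_eq_one_iff_eq (by positivity)]; ring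
      · congr 1; ring
    · rw [ratioLim_of_notMem h0]

lemma nodeStrong_comm (φ : Fin 4 → ℝ) (p q : ℝ × ℝ) : nodeStrong φ p q = nodeStrong φ q p := by
  simp only [nodeStrong]; ring

lemma nodeWeak_comm (φ : Fin 4 → ℝ) (p q : ℝ × ℝ) : nodeWeak φ p q = nodeWeak φ q p := by
  simp only [nodeWeak]; ring

/-- The recursion is symmetric in the branches; this form singles out the branch on the path to the
marked vertex. -/
lemma limSums_node {T : Set Vertex} (hT : [] ∈ T) (b : Bool) (n : ℕ)
    (f : Vertex → Fin 4 → ℝ) : limSums (n + 1) f T =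
      (nodeStrong (f []) (limSums n (shift b f) (branch b T))
          (limSums n (shift (!b) f) (branch (!b) T)) /
        (2 + ratioLim (branch (!b) T) + ratioLim (branch b T)),
       nodeWeak (f []) (limSums n (shift b f) (branch b T))
          (limSums n (shift (!b) f) (branch (!b) T)) /
        (2 + ratioLim (branch (!b) T) + ratioLim (branch b T))) := by
  rw [limSums, if_pos hT]
  cases b
  · simp only [Bool.not_false, add_right_comm]
  · rw [nodeStrong_comm, nodeWeak_comm]; rfl

lemma ratioLim_node' {T : Set Vertex} (hT : [] ∈ T) (b : Bool) : ratioLim T =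
    (1 + ratioLim (branch (!b) T)) * (1 + ratioLim (branch b T)) /
      (2 + ratioLim (branch (!b) T) + ratioLim (branch b T)) := by
  rw [ratioLim_node hT]
  cases b
  · simp only [Bool.not_false, add_right_comm]
    rw [mul_comm]
  · rfl

/-- The determinant `S^g X - W^g` that governs the covariance of the root with `v`, where
`S^g`, `W^g` are the normalized strong and weak sums of the height at `v`, and `X` is the
characteristic ratio. -/
def pathDelta : Vertex → Set Vertex → ℝ
  | [], T => (3 + 3 * (ratioLim (branch false T) + ratioLim (branch true T)) +
      (ratioLim (branch false T) + ratioLim (branch true T)) ^ 2 -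
      ratioLim (branch false T) * ratioLim (branch true T)) /
      (2 + ratioLim (branch false T) + ratioLim (branch true T)) ^ 2
  | b :: v, T => ((1 + ratioLim (branch (!b) T)) /
      (2 + ratioLim (branch (!b) T) + ratioLim (branch b T))) ^ 2 * pathDelta v (branch b T)

lemma shift_marked_self (b : Bool) (v : Vertex) (g : Fin 4 → ℝ) :
    shift b (marked (b :: v) g) = marked v g := by
  funext u h; simp [shift, marked]

lemma shift_marked_not (b : Bool) (v : Vertex) (g : Fin 4 → ℝ) :
    shift (!b) (marked (b :: v) g) = fun _ _ => 1 := by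
  funext u h; simp [shift, marked]

lemma shift_marked_nil (b : Bool) (g : Fin 4 → ℝ) :
    shift b (marked [] g) = fun _ _ => 1 := by
  funext u h; simp [shift, marked]

lemma marked_cons_nil (b : Bool) (v : Vertex) (g : Fin 4 → ℝ) :
    marked (b :: v) g [] = fun _ => 1 := by
  funext h; simp [marked]

lemma marked_nil_nil (g : Fin 4 → ℝ) : marked [] g [] = g := by
  funext h; simp [marked]

/-- The left side is the determinant of the marked pair and the unmarked pair `(1, X)`. A step up
the path applies to both the matrix with rows `(2 + x, 1)`, `(1 + x, 1 + x)`, of determinant `(1 +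
x)²`, divided by the normalization `2 + x + X`. -/
lemma limSums_delta {n : ℕ} {v : Vertex} {T : Set Vertex} (hT : PrefixClosed T) (hv : v ∈ T)
    (hn : v.length < n) :
    (limSums n (marked v height) T).1 * ratioLim T - (limSums n (marked v height) T).2 =
      pathDelta v T := by
  induction v generalizing n T with
  | nil =>
    obtain ⟨m, rfl⟩ := Nat.exists_eq_succ_of_ne_zero (by omega : n ≠ 0)
    have p := ratioLim_nonneg (branch false T)
    have q := ratioLim_nonneg (branch true T)
    rw [limSums, if_pos hv, ratioLim_node hv, shift_marked_nil, shift_marked_nil, marked_nil_nil,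
      limSums_one, limSums_one, pathDelta]
    simp only [nodeStrong, nodeWeak, height_one, height_two, height_three]
    field_simp
    ring
  | cons b v ih =>
    have h0 : [] ∈ T := hT [] _ List.nil_prefix hv
    obtain ⟨m, rfl⟩ := Nat.exists_eq_succ_of_ne_zero (by omega : n ≠ 0)
    have p := ratioLim_nonneg (branch b T)
    have q := ratioLim_nonneg (branch (!b) T)
    rw [limSums_node h0 b, ratioLim_node' h0 b, shift_marked_self, shift_marked_not,
      marked_cons_nil, limSums_one, pathDelta, ← ih (hT.branch b) hv (by simpa using hn)]
    simp only [nodeStrong, nodeWeak]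
    field_simp
    ring

/-- The determinant `pathDelta`, divided by the square of the partition sum with weight `r₁` of
the strongly and `r₂` of the weakly allowed configurations. -/
def pathKernel (v : Vertex) (r₁ r₂ : ℝ) (T : Set Vertex) : ℝ :=
  pathDelta v T / (r₁ + r₂ * ratioLim T) ^ 2

/-- The factor gained by the determinant equals the square of the one gained by the partition sum,
so a step down the path only multiplies the row `(r₁, r₂)` by the matrix with rows `(1 + θ, θ)`,
`(1, 1)`, where `θ = (1 + x)⁻¹`. -/
lemma pathKernel_cons {b : Bool} {v : Vertex} {r₁ r₂ : ℝ} (h₁ : 0 < r₁) (h₂ : 0 ≤ r₂)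
    {T : Set Vertex} (hT : [] ∈ T) : pathKernel (b :: v) r₁ r₂ T =
      pathKernel v (r₁ * (1 + (1 + ratioLim (branch (!b) T))⁻¹) + r₂)
        (r₁ * (1 + ratioLim (branch (!b) T))⁻¹ + r₂) (branch b T) := by
  have p := ratioLim_nonneg (branch b T)
  have q := ratioLim_nonneg (branch (!b) T)
  have e : r₁ * (1 + (1 + ratioLim (branch (!b) T))⁻¹) + r₂ +
      (r₁ * (1 + ratioLim (branch (!b) T))⁻¹ + r₂) * ratioLim (branch b T) =
      (r₁ + r₂ * ((1 + ratioLim (branch (!b) T)) * (1 + ratioLim (branch b T)) /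
      (2 + ratioLim (branch (!b) T) + ratioLim (branch b T)))) /
      ((1 + ratioLim (branch (!b) T)) /
        (2 + ratioLim (branch (!b) T) + ratioLim (branch b T))) := by
    field_simp
    ring
  have h1 : 0 < (r₁ + r₂ * ((1 + ratioLim (branch (!b) T)) * (1 + ratioLim (branch b T)) /
      (2 + ratioLim (branch (!b) T) + ratioLim (branch b T)))) := by positivity
  have h2 : 0 < ((1 + ratioLim (branch (!b) T)) /
        (2 + ratioLim (branch (!b) T) + ratioLim (branch b T))) := by positivity
  rw [pathKernel, pathKernel, e, pathDelta, ratioLim_node' hT b]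
  generalize (1 + ratioLim (branch (!b) T)) /
    (2 + ratioLim (branch (!b) T) + ratioLim (branch b T)) = κ at *
  generalize r₁ + r₂ * ((1 + ratioLim (branch (!b) T)) * (1 + ratioLim (branch b T)) /
    (2 + ratioLim (branch (!b) T) + ratioLim (branch b T))) = A at *
  field_simp

/-- The covariance of the heights at the root and at `v`. -/
def covFormula : Vertex → Set Vertex → ℝ
  | [], T => (6 + 7 * (ratioLim (branch false T) + ratioLim (branch true T)) +
      5 * (ratioLim (branch false T) * ratioLim (branch true T)) +
      (ratioLim (branch false T) + ratioLim (branch true T)) ^ 2 +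
      (ratioLim (branch false T) + ratioLim (branch true T)) *
        (ratioLim (branch false T) * ratioLim (branch true T))) /
      (3 + 2 * (ratioLim (branch false T) + ratioLim (branch true T)) +
        ratioLim (branch false T) * ratioLim (branch true T)) ^ 2
  -- Summing over the root height, the pair `(S, W)` of the path branch has weights `(3 + 2x, 2 +
  -- x)` without and `(6 + 5x, 5 + 3x)` with the height factor. The determinant of the second row
  -- and the first is `-(3 + 3x + x²)`.
  | b :: v, T => -((3 + 3 * ratioLim (branch (!b) T) + ratioLim (branch (!b) T) ^ 2) *
      pathKernel v (3 + 2 * ratioLim (branch (!b) T)) (2 + ratioLim (branch (!b) T))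
        (branch b T))

lemma obs_marked {n : ℕ} {v : Vertex} (hn : v.length < n) (g : Fin 4 → ℝ) (η : Config) :
    obs n (marked v g) η = g (η v) := by
  rw [obs_eq_prod (I := {v}) (by simpa using hn) (by intro u hu h; simp_all [marked])]
  simp [marked]

lemma obs_mul (n : ℕ) (f g : Vertex → Fin 4 → ℝ) (η : Config) :
    obs n (fun u h => f u h * g u h) η = obs n f η * obs n g η := by
  induction n generalizing f g η with
  | zero => simp [obs]
  | succ n ih =>
    have e : ∀ b, shift b (fun u h => f u h * g u h) =
      fun u h => shift b f u h * shift b g u h := fun _ => rfl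
    rw [obs, obs, obs, e, e, ih, ih]
    ring

lemma heightCov_eq_sub {T : Set Vertex} (hT : IsRootedSubtree T) {μ : ProbabilityMeasure Config}
    (hμ : IsSandpileMeasure T μ) {v : Vertex} {n : ℕ} (hn : v.length < n) :
    heightCov μ [] v =
      limMean n (fun u h => marked [] height u h * marked v height u h) T -
        limMean n (marked [] height) T * limMean n (marked v height) T := by
  have hL : ∀ u : Vertex, MemLp (fun η : Config => ((η u : ℕ) : ℝ)) 2 (μ : Measure Config) := by
    intro u
    refine MemLp.of_bound (C := 4) ?_ (Eventually.of_forall fun η => ?_)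
    · have : Measurable fun η : Config => height (η u) := by
        have : Measurable height := measurable_of_finite _
        fun_prop
      exact this.aestronglyMeasurable
    · have := (η u).isLt
      simp only [Real.norm_natCast]
      exact_mod_cast this.le
  have hn0 : ([] : Vertex).length < n := by simp; omega
  rw [heightCov, covariance_eq_sub (hL _) (hL _), ← hμ.integral_obs hT, ← hμ.integral_obs hT,
    ← hμ.integral_obs hT]
  simp only [obs_mul, obs_marked hn, obs_marked hn0]
  rfl

/-- For `v` other than the root, this is the identity `(a·p)(r·u) - (a·u)(r·p) = det(a, r) det(p,
u)`: `a`, `r` are the root weights with and without the height, and `p`, `u` are the marked and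
unmarked pairs of the path branch. -/
lemma heightCov_eq {T : Set Vertex} (hT : IsRootedSubtree T) {μ : ProbabilityMeasure Config}
    (hμ : IsSandpileMeasure T μ) {v : Vertex} (hv : v ∈ T) :
    heightCov μ [] v = covFormula v T := by
  rw [heightCov_eq_sub hT hμ (Nat.lt_succ_self _)]
  rcases v with _ | ⟨b, v⟩
  · have p := ratioLim_nonneg (branch false T)
    have q := ratioLim_nonneg (branch true T)
    have e : ∀ b, shift b (fun u h => marked [] height u h * marked [] height u h) =
        fun _ _ => 1 := by
      intro b; funext u h; simp [shift, marked]
    simp only [limMean, limSums, if_pos hv, shift_marked_nil, marked_nil_nil, limSums_one, e,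
      covFormula, ratioLim_node hv, nodeStrong, nodeWeak, height_one, height_two, height_three]
    have h1 : 0 < 2 + ratioLim (branch false T) + ratioLim (branch true T) := by positivity
    have h2 : 1 + (1 + ratioLim (branch false T)) * (1 + ratioLim (branch true T)) /
        (2 + ratioLim (branch false T) + ratioLim (branch true T)) =
        (3 + 2 * (ratioLim (branch false T) + ratioLim (branch true T)) +
        ratioLim (branch false T) * ratioLim (branch true T)) /
        (2 + ratioLim (branch false T) + ratioLim (branch true T)) := by
      field_simp; ring
    rw [h2]
    have h3 : 0 < (3 + 2 * (ratioLim (branch false T) + ratioLim (branch true T)) +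
        ratioLim (branch false T) * ratioLim (branch true T)) := by positivity
    field_simp
    ring
  · have p := ratioLim_nonneg (branch b T)
    have q := ratioLim_nonneg (branch (!b) T)
    have e1 : shift b (fun u h => marked [] height u h * marked (b :: v) height u h) =
        marked v height := by
      funext u h; simp [shift, marked]
    have e2 : shift (!b) (fun u h => marked [] height u h * marked (b :: v) height u h) =
        fun _ _ => 1 := by
      funext u h; simp [shift, marked]
    simp only [limMean, covFormula, pathKernel, Nat.succ_eq_add_one, limSums_node hT.1 b, e1, e2,
      shift_marked_self, shift_marked_not, shift_marked_nil, marked_cons_nil, marked_nil_nil,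
      ← limSums_delta (PrefixClosed.branch hT.2 b) hv (Nat.lt_succ_self v.length), limSums_one,
      ratioLim_node' hT.1 b, nodeStrong, nodeWeak, height_one, height_two, height_three,
      List.length_cons]
    generalize limSums (v.length + 1) (marked v height) (branch b T) = P
    obtain ⟨P, R⟩ := P
    generalize ratioLim (branch b T) = X at *
    generalize ratioLim (branch (!b) T) = x at *
    have h2 : 1 + (1 + x) * (1 + X) / (2 + x + X) =
        (3 + 2 * x + (2 + x) * X) / (2 + x + X) := by
      field_simp; ring
    rw [h2]
    field_simp
    ring

/-- Crude constants: for ratios in `[0, 1]` the numerator lies between 3 and 13, the denominator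
between 4 and 16. -/
lemma pathDelta_nil_mem (T : Set Vertex) :
    1 / 16 ≤ pathDelta [] T ∧ pathDelta [] T ≤ 13 := by
  have p := ratioLim_nonneg (branch false T)
  have q := ratioLim_nonneg (branch true T)
  have p1 := ratioLim_le_one (branch false T)
  have q1 := ratioLim_le_one (branch true T)
  rw [pathDelta]
  generalize ratioLim (branch false T) = y at *
  generalize ratioLim (branch true T) = z at *
  have : 0 < (2 + y + z) ^ 2 := by positivity
  constructor
  · rw [le_div_iff₀ this]; nlinarith [mul_nonneg p q]
  · rw [div_le_iff₀ this]; nlinarith [mul_nonneg p q]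

lemma pathDelta_pos (v : Vertex) (T : Set Vertex) : 0 < pathDelta v T := by
  induction v generalizing T with
  | nil => linarith [(pathDelta_nil_mem T).1]
  | cons b v ih =>
    have p := ratioLim_nonneg (branch b T)
    have q := ratioLim_nonneg (branch (!b) T)
    have := ih (branch b T)
    rw [pathDelta]
    positivity

lemma pathKernel_pos (v : Vertex) {r₁ r₂ : ℝ} (h₁ : 0 < r₁) (h₂ : 0 ≤ r₂) (T : Set Vertex) :
    0 < pathKernel v r₁ r₂ T := by
  have := ratioLim_nonneg T
  have := pathDelta_pos v T
  unfold pathKernel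
  positivity

lemma covFormula_nil_pos (T : Set Vertex) : 0 < covFormula [] T := by
  have p := ratioLim_nonneg (branch false T)
  have q := ratioLim_nonneg (branch true T)
  rw [covFormula]
  positivity

/-- The sign is strict for every tree, so the mean of the absolute covariance cannot vanish. -/
lemma covFormula_cons_neg (b : Bool) (v : Vertex) (T : Set Vertex) :
    covFormula (b :: v) T < 0 := by
  have q := ratioLim_nonneg (branch (!b) T)
  have := pathKernel_pos v (r₁ := 3 + 2 * ratioLim (branch (!b) T))
    (r₂ := 2 + ratioLim (branch (!b) T)) (by positivity) (by positivity) (branch b T)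
  rw [covFormula, neg_lt_zero]
  positivity

/-! ### The branching measure -/

/-- The branching variables of the descendants of the child `[b]`. -/
def tailBranching (b : Bool) (ω : Branching) : Branching := fun u => ω (b :: u)

/-- Assembles branching variables at the root, below `[!b]`, and below `[b]`. -/
def joinBranching (b : Bool) (x : Bool × Branching × Branching) : Branching
  | [] => x.1
  | a :: u => if a = b then x.2.2 u else x.2.1 u

lemma measurable_tailBranching (b : Bool) : Measurable (tailBranching b) :=
  measurable_pi_lambda _ fun _ => measurable_pi_apply _

lemma measurable_joinBranching (b : Bool) : Measurable (joinBranching b) := by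
  refine measurable_pi_lambda _ fun u => ?_
  rcases u with _ | ⟨a, u⟩
  · exact measurable_fst
  · simp only [joinBranching]
    split_ifs <;> fun_prop

lemma measurableSet_root : MeasurableSet {ω : Branching | ω [] = true} :=
  (measurable_pi_apply (X := fun _ : Vertex => Bool) []) (measurableSet_singleton true)

/-- The branching property: the variable at the root and the two families below its children are
independent, each family distributed like the whole. It is checked on cylinders. -/
lemma map_joinBranching (p : unitInterval) (b : Bool) :
    ((bernoulliMeasure true false p).prod ((branchingMeasure p).prod (branchingMeasure p))).map
      (joinBranching b) = branchingMeasure p := by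
  classical
  refine Measure.eq_infinitePi _ fun s t ht => ?_
  have hpre : joinBranching b ⁻¹' (Set.pi s t) = (if [] ∈ s then t [] else Set.univ) ×ˢ
      ((Set.pi (finBranch (!b) s) fun u => t ((!b) :: u)) ×ˢ
        (Set.pi (finBranch b s) fun u => t (b :: u))) := by
    ext ⟨x, ω₀, ω₁⟩
    simp only [Set.mem_preimage, Set.mem_pi, Finset.mem_coe, Set.mem_prod, mem_finBranch]
    constructor
    · intro h
      refine ⟨?_, fun u hu => ?_, fun u hu => ?_⟩
      · split_ifs with h0
        · exact h [] h0
        · trivial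
      · simpa [joinBranching] using h _ hu
      · simpa [joinBranching] using h _ hu
    · rintro ⟨h0, h1, h2⟩ u hu
      rcases u with _ | ⟨a, u⟩
      · simpa [hu, joinBranching] using h0
      · by_cases hab : a = b
        · subst hab
          simpa [joinBranching] using h2 u hu
        · have : a = !b := by revert hab; cases a <;> cases b <;> decide
          subst this
          simpa [joinBranching] using h1 u hu
  have hpi : ∀ a, branchingMeasure p (Set.pi (finBranch a s) fun u => t (a :: u)) =
      ∏ u ∈ finBranch a s, bernoulliMeasure true false p (t (a :: u)) := fun a =>
    Measure.infinitePi_pi _ fun u _ => ht _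
  rw [Measure.map_apply (measurable_joinBranching b)
    (MeasurableSet.pi s.countable_toSet fun u _ => ht u), hpre, Measure.prod_prod,
    Measure.prod_prod, hpi, hpi, prod_vertices (I := s), ← mul_assoc]
  have h0 : bernoulliMeasure true false p (if [] ∈ s then t [] else Set.univ) =
      if [] ∈ s then bernoulliMeasure true false p (t []) else 1 := by
    split_ifs
    · rfl
    · exact measure_univ
  rw [h0]
  cases b
  · simp only [Bool.not_false]; ring
  · rfl

lemma lintegral_branching_node (p : unitInterval) (b : Bool)
    {F : Branching × Branching → ENNReal} (hF : Measurable F) :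
    ∫⁻ ω in {ω | ω [] = true}, F (tailBranching (!b) ω, tailBranching b ω)
        ∂(branchingMeasure p) =
      ENNReal.ofReal p * ∫⁻ ω, ∫⁻ ω', F (ω, ω') ∂(branchingMeasure p) ∂(branchingMeasure p) := by
  have hb : ∀ x, tailBranching b (joinBranching b x) = x.2.2 := by
    intro x; funext u; simp [tailBranching, joinBranching]
  have hnb : ∀ x, tailBranching (!b) (joinBranching b x) = x.2.1 := by
    intro x; funext u; simp [tailBranching, joinBranching]
  have hFt : Measurable fun ω => F (tailBranching (!b) ω, tailBranching b ω) :=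
    hF.comp ((measurable_tailBranching _).prodMk (measurable_tailBranching _))
  have hpre : joinBranching b ⁻¹' {ω | ω [] = true} = {true} ×ˢ Set.univ := by
    ext ⟨x, y⟩; simp [joinBranching]
  conv_lhs => rw [← map_joinBranching p b]
  rw [setLIntegral_map measurableSet_root hFt (measurable_joinBranching b), hpre]
  simp only [hb, hnb]
  rw [← Measure.prod_restrict, lintegral_prod _ (by fun_prop)]
  simp only [Measure.restrict_univ]
  rw [lintegral_const, lintegral_prod _ hF.aemeasurable, Measure.restrict_apply_univ,
    bernoulliMeasure_apply_of_mem_of_notMem _ (measurableSet_singleton _) (by simp) (by simp),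
    mul_comm]
  congr 1
  rw [ENNReal.ofReal]
  congr 1
  ext
  simp [p.2.1]

/-! ### The random tree -/

lemma nil_mem_randomTree (ω : Branching) : [] ∈ randomTree ω := by
  intro u hu hne
  exact absurd (List.prefix_nil.1 hu) hne

lemma cons_mem_randomTree {b : Bool} {v : Vertex} {ω : Branching} :
    b :: v ∈ randomTree ω ↔ ω [] = true ∧ v ∈ randomTree (tailBranching b ω) := by
  constructor
  · intro h
    exact ⟨h [] List.nil_prefix (by simp), fun u hu hne => h (b :: u) (by simpa using hu)
      (by simpa using hne)⟩
  · rintro ⟨h0, h⟩ u hu hne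
    rcases u with _ | ⟨a, u⟩
    · exact h0
    · obtain ⟨rfl, hu'⟩ := List.cons_prefix_cons.1 hu
      exact h u hu' (by simpa using hne)

lemma isRootedSubtree_randomTree (ω : Branching) : IsRootedSubtree (randomTree ω) := by
  refine ⟨nil_mem_randomTree ω, fun u v huv hv w hwu hne => hv w (hwu.trans huv) ?_⟩
  rintro rfl
  exact hne (hwu.eq_of_length_le huv.length_le)

lemma branch_randomTree {ω : Branching} (h : ω [] = true) (b : Bool) :
    branch b (randomTree ω) = randomTree (tailBranching b ω) := by
  ext u; simp [cons_mem_randomTree, h]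

lemma branch_randomTree_false {ω : Branching} (h : ω [] = false) (b : Bool) :
    branch b (randomTree ω) = ∅ := by
  ext u; simp [cons_mem_randomTree, h]

lemma measurableSet_mem_randomTree (v : Vertex) :
    MeasurableSet {ω : Branching | v ∈ randomTree ω} := by
  induction v with
  | nil => simp [nil_mem_randomTree]
  | cons b v ih =>
    simp only [cons_mem_randomTree]
    exact measurableSet_root.inter (measurable_tailBranching b ih)

open Classical in
-- The branch is the random tree of the shifted variables if the root branches and empty otherwise,
-- so no σ-algebra on sets of vertices is needed.
lemma measurable_branch_randomTree {g : Set Vertex → ℝ} (b : Bool)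
    (h : Measurable fun ω => g (randomTree ω)) :
    Measurable fun ω => g (branch b (randomTree ω)) := by
  have : (fun ω => g (branch b (randomTree ω))) =
      fun ω => if ω ∈ {ω : Branching | ω [] = true} then g (randomTree (tailBranching b ω))
        else g ∅ := by
    funext ω
    by_cases hω : ω [] = true
    · simp [hω, branch_randomTree hω]
    · simp [hω, branch_randomTree_false (Bool.eq_false_iff.2 hω)]
  rw [this]
  exact Measurable.ite measurableSet_root (h.comp (measurable_tailBranching b)) measurable_const

lemma measurable_ratio (n : ℕ) : Measurable fun ω => ratio n (randomTree ω) := by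
  induction n with
  | zero => exact measurable_const
  | succ n ih =>
    simp only [ratio, nil_mem_randomTree, if_true]
    have h0 := measurable_branch_randomTree false ih
    have h1 := measurable_branch_randomTree true ih
    fun_prop

/-- The characteristic ratio of the random tree. -/
def treeRatio (ω : Branching) : ℝ := ratioLim (randomTree ω)

lemma measurable_treeRatio : Measurable treeRatio :=
  measurable_of_tendsto_metrizable measurable_ratio
    (tendsto_pi_nhds.2 fun ω => tendsto_ratio (randomTree ω))

lemma half_le_treeRatio (ω : Branching) : 1 / 2 ≤ treeRatio ω :=
  half_le_ratioLim (nil_mem_randomTree ω)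

lemma treeRatio_le_one (ω : Branching) : treeRatio ω ≤ 1 := ratioLim_le_one _

lemma measurable_pathDelta (v : Vertex) : Measurable fun ω => pathDelta v (randomTree ω) := by
  induction v with
  | nil =>
    have h0 := measurable_branch_randomTree false measurable_treeRatio
    have h1 := measurable_branch_randomTree true measurable_treeRatio
    simp only [pathDelta]
    fun_prop
  | cons b v ih =>
    have h0 := measurable_branch_randomTree b measurable_treeRatio
    have h1 := measurable_branch_randomTree (!b) measurable_treeRatio
    have h2 := measurable_branch_randomTree b ih
    simp only [pathDelta]
    fun_prop

lemma measurable_covFormula (v : Vertex) : Measurable fun ω => covFormula v (randomTree ω) := by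
  rcases v with _ | ⟨b, v⟩
  · have h0 := measurable_branch_randomTree false measurable_treeRatio
    have h1 := measurable_branch_randomTree true measurable_treeRatio
    simp only [covFormula]
    fun_prop
  · have h0 := measurable_branch_randomTree b measurable_treeRatio
    have h1 := measurable_branch_randomTree (!b) measurable_treeRatio
    have h2 := measurable_branch_randomTree b (measurable_pathDelta v)
    simp only [covFormula, pathKernel]
    fun_prop

/-- Generations `0, …, N` are the words of length less than `N + 1`, whence the shift. -/
lemma randomTreeUpTo_eq (N : ℕ) (ω : Branching) :
    charRatio (randomTreeUpTo N ω) = ratio (N + 1) (randomTree ω) := by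
  have hmem : ∀ u, u ∈ randomTreeUpTo N ω ↔ u ∈ randomTree ω ∧ u.length ≤ N := by
    intro u; simp [randomTreeUpTo]
  have hpc : PrefixClosed (randomTreeUpTo N ω : Set Vertex) := by
    intro u v huv hv
    simp only [Finset.mem_coe, hmem] at hv ⊢
    exact ⟨(isRootedSubtree_randomTree ω).2 u v huv hv.1, huv.length_le.trans hv.2⟩
  rw [charRatio_eq_ratio hpc fun u hu => Nat.lt_succ_of_le ((hmem u).1 hu).2]
  refine le_antisymm (ratio_mono_tree fun u hu _ => ((hmem u).1 hu).1)
    (ratio_mono_tree fun u hu hu' => ?_)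
  exact (hmem u).2 ⟨hu, Nat.le_of_lt_succ hu'⟩

lemma tendsto_charRatio_randomTree (ω : Branching) :
    Tendsto (fun N => charRatio (randomTreeUpTo N ω)) atTop (𝓝 (treeRatio ω)) := by
  simp only [randomTreeUpTo_eq]
  exact (tendsto_ratio (randomTree ω)).comp (tendsto_add_atTop_nat 1)

/-- The law of the characteristic ratio of the random tree. -/
def ratioLaw (p : unitInterval) : ProbabilityMeasure ℝ :=
  ⟨(branchingMeasure p).map treeRatio,
    Measure.isProbabilityMeasure_map measurable_treeRatio.aemeasurable⟩

/-- All the trees live on one probability space, where the ratios converge for every `ω`. -/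
lemma tendstoInDistribution_charRatio (p : unitInterval) :
    TendstoInDistribution (fun (N : ℕ) ω => charRatio (randomTreeUpTo N ω)) atTop
      (id : ℝ → ℝ) (fun _ => branchingMeasure p) (ratioLaw p : Measure ℝ) := by
  have hm : ∀ N, Measurable fun ω => charRatio (randomTreeUpTo N ω) := fun N => by
    simp only [randomTreeUpTo_eq]
    exact measurable_ratio _
  have h := tendstoInDistribution_of_ae_tendsto (μ' := branchingMeasure p)
    (fun N => (hm N).aemeasurable) measurable_treeRatio.aemeasurable
    (Eventually.of_forall tendsto_charRatio_randomTree)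
  refine ⟨h.forall_aemeasurable, aemeasurable_id, ?_⟩
  convert h.tendsto using 2
  exact congrArg 𝓝 (Subtype.ext Measure.map_id)

/-- The random variable `(1 + x₁)⁻¹`. -/
def theta (ω : Branching) : ℝ := (1 + treeRatio ω)⁻¹

lemma measurable_theta : Measurable theta := (measurable_treeRatio.const_add 1).inv

lemma half_le_theta (ω : Branching) : 1 / 2 ≤ theta ω := by
  have := half_le_treeRatio ω
  have := treeRatio_le_one ω
  rw [theta, one_div]
  exact inv_anti₀ (by linarith) (by linarith)

/-- The root always belongs to the tree, which forces `x₁ ≥ 1/2`; this is the source of the constant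
with `√7`. -/
lemma theta_le (ω : Branching) : theta ω ≤ 2 / 3 := by
  have := half_le_treeRatio ω
  rw [theta, show (2 / 3 : ℝ) = (3 / 2)⁻¹ by norm_num]
  exact inv_anti₀ (by norm_num) (by linarith)

lemma theta_pos (ω : Branching) : 0 < theta ω := by linarith [half_le_theta ω]

lemma integrable_theta (p : unitInterval) : Integrable theta (branchingMeasure p) :=
  Integrable.of_bound measurable_theta.aestronglyMeasurable (2 / 3)
    (Eventually.of_forall fun ω => by
      rw [Real.norm_of_nonneg (theta_pos ω).le]; exact theta_le ω)

lemma gammaOf_ratioLaw (p : unitInterval) :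
    gammaOf (ratioLaw p : Measure ℝ) = (∫ ω, theta ω ∂(branchingMeasure p))⁻¹ := by
  rw [gammaOf]
  congr 1
  change ∫ x, (1 + x)⁻¹ ∂((branchingMeasure p).map treeRatio) = _
  rw [integral_map measurable_treeRatio.aemeasurable
    (by fun_prop : Measurable fun x : ℝ => (1 + x)⁻¹).aestronglyMeasurable]
  rfl

/-! ### Products of independent random matrices -/

/-- `E (r N₁ ⋯ Nₙ 1)⁻²` for the row vector `r = (r₁, r₂)` and independent copies `Nᵢ` of the
matrix with rows `(1 + θ, θ)` and `(1, 1)`. -/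
def matrixMoment (p : unitInterval) : ℕ → ℝ → ℝ → ENNReal
  | 0, r₁, r₂ => ENNReal.ofReal (((r₁ + r₂) ^ 2)⁻¹)
  | n + 1, r₁, r₂ => ∫⁻ ω, matrixMoment p n (r₁ * (1 + theta ω) + r₂) (r₁ * theta ω + r₂)
      ∂(branchingMeasure p)

variable {p : unitInterval}

/-- Right multiplication by nonnegative matrices preserves `r ≤ c s`, and the final inverse square
turns `c` into `c²`. -/
lemma matrixMoment_le_of_le (n : ℕ) {r₁ r₂ s₁ s₂ c : ℝ} (hr₁ : 0 < r₁) (hr₂ : 0 < r₂)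
    (h₁ : r₁ ≤ c * s₁) (h₂ : r₂ ≤ c * s₂) (hs₁ : 0 < s₁) (hs₂ : 0 < s₂) :
    matrixMoment p n s₁ s₂ ≤ ENNReal.ofReal (c ^ 2) * matrixMoment p n r₁ r₂ := by
  induction n generalizing r₁ r₂ s₁ s₂ with
  | zero =>
    rw [matrixMoment, matrixMoment, ← ENNReal.ofReal_mul (sq_nonneg c)]
    refine ENNReal.ofReal_le_ofReal ?_
    have hs : 0 < s₁ + s₂ := by positivity
    have hr : 0 < r₁ + r₂ := by positivity
    rw [← div_eq_mul_inv, inv_eq_one_div, div_le_div_iff₀ (by positivity) (by positivity), one_mul,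
      ← mul_pow]
    exact pow_le_pow_left₀ hr.le (by linarith) 2
  | succ n ih =>
    rw [matrixMoment, matrixMoment, ← lintegral_const_mul' _ _ ENNReal.ofReal_ne_top]
    refine lintegral_mono fun ω => ?_
    have ht := theta_pos ω
    refine ih (by positivity) (by positivity) ?_ ?_ (by positivity) (by positivity)
    · nlinarith
    · nlinarith

/-- Each matrix only increases the sum of the entries of the row; this gives finiteness of the
moments. -/
lemma matrixMoment_le_zero (n : ℕ) {r₁ r₂ : ℝ} (hr₁ : 0 < r₁) (hr₂ : 0 < r₂) :
    matrixMoment p n r₁ r₂ ≤ ENNReal.ofReal (((r₁ + r₂) ^ 2)⁻¹) := by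
  induction n generalizing r₁ r₂ with
  | zero => exact le_rfl
  | succ n ih =>
    rw [matrixMoment]
    refine (lintegral_mono (g := fun _ => ENNReal.ofReal (((r₁ + r₂) ^ 2)⁻¹)) fun ω => ?_).trans
      (by simp)
    have ht := theta_pos ω
    refine (ih (by positivity) (by positivity)).trans (ENNReal.ofReal_le_ofReal ?_)
    refine inv_anti₀ (by positivity) (pow_le_pow_left₀ (by positivity) ?_ 2)
    nlinarith

/-- The row reached after `n` steps is at most its entry sum times `(1, 1)`, so the remaining `m`
steps can restart from `(1, 1)` at the cost of that sum. Inverse squares reverse the inequality. -/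
lemma matrixMoment_mul_le (n m : ℕ) {r₁ r₂ : ℝ} (hr₁ : 0 < r₁) (hr₂ : 0 < r₂) :
    matrixMoment p n r₁ r₂ * matrixMoment p m 1 1 ≤ matrixMoment p (n + m) r₁ r₂ := by
  induction n generalizing r₁ r₂ with
  | zero =>
    have hr : 0 < r₁ + r₂ := by positivity
    have h := matrixMoment_le_of_le (p := p) m (c := r₁ + r₂) hr₁ hr₂ (s₁ := 1) (s₂ := 1)
      (by linarith) (by linarith) one_pos one_pos
    rw [matrixMoment, zero_add]
    refine (mul_le_mul_right h _).trans ?_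
    rw [← mul_assoc, ← ENNReal.ofReal_mul (by positivity),
      inv_mul_cancel₀ (by positivity : (r₁ + r₂) ^ 2 ≠ 0), ENNReal.ofReal_one, one_mul]
  | succ n ih =>
    have hne : matrixMoment p m 1 1 ≠ ⊤ :=
      ((matrixMoment_le_zero m one_pos one_pos).trans_lt ENNReal.ofReal_lt_top).ne
    rw [add_right_comm, matrixMoment, matrixMoment, ← lintegral_mul_const' _ _ hne]
    refine lintegral_mono fun ω => ?_
    have ht := theta_pos ω
    exact ih (by positivity) (by positivity)

/-- Jensen's inequality for the convex function `x ↦ x⁻²`. -/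
lemma ofReal_inv_sq_integral_le {Ω : Type*} [MeasurableSpace Ω] {P : Measure Ω}
    [IsProbabilityMeasure P] {X : Ω → ℝ} (hX : Integrable X P) {c : ℝ} (hc : 0 < c)
    (hcX : ∀ ω, c ≤ X ω) :
    ENNReal.ofReal (((∫ ω, X ω ∂P) ^ 2)⁻¹) ≤ ∫⁻ ω, ENNReal.ofReal ((X ω ^ 2)⁻¹) ∂P := by
  have hM : c ≤ ∫ ω, X ω ∂P := by
    have := integral_mono (integrable_const c) hX hcX
    simpa using this
  set M := ∫ ω, X ω ∂P with hMdef
  have hM0 : 0 < M := hc.trans_le hM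
  have hint : Integrable (fun ω => (X ω ^ 2)⁻¹) P := by
    refine Integrable.of_bound
      ((hX.1.aemeasurable.pow_const 2).inv).aestronglyMeasurable ((c ^ 2)⁻¹)
      (Eventually.of_forall fun ω => ?_)
    rw [Real.norm_of_nonneg (by positivity)]
    exact inv_anti₀ (by positivity) (pow_le_pow_left₀ hc.le (hcX ω) 2)
  rw [← ofReal_integral_eq_lintegral_ofReal hint
    (Eventually.of_forall fun ω => inv_nonneg.2 (sq_nonneg _))]
  refine ENNReal.ofReal_le_ofReal ?_
  -- The left side is the tangent line of `x ↦ x⁻²` at the mean `M`; the gap factors with a double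
  -- root at `M`.
  have htan : ∀ ω, 3 * (M ^ 2)⁻¹ - 2 * (M ^ 3)⁻¹ * X ω ≤ (X ω ^ 2)⁻¹ := by
    intro ω
    have hx : 0 < X ω := hc.trans_le (hcX ω)
    have e : (X ω ^ 2)⁻¹ - (3 * (M ^ 2)⁻¹ - 2 * (M ^ 3)⁻¹ * X ω) =
        (X ω - M) ^ 2 * (2 * X ω + M) / (X ω ^ 2 * M ^ 3) := by
      field_simp
      ring
    have : 0 ≤ (X ω - M) ^ 2 * (2 * X ω + M) / (X ω ^ 2 * M ^ 3) := by positivity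
    linarith
  have h := integral_mono ((integrable_const _).sub (hX.const_mul _)) hint htan
  refine le_trans (le_of_eq ?_) h
  simp only [Pi.sub_apply]
  rw [integral_sub (integrable_const _) (hX.const_mul _), integral_const, integral_const_mul,
    ← hMdef]
  simp
  field_simp
  norm_num

/-- The expectation of `(1 + x₁)⁻¹`. -/
def meanTheta (p : unitInterval) : ℝ := ∫ ω, theta ω ∂(branchingMeasure p)

lemma half_le_meanTheta : 1 / 2 ≤ meanTheta p := by
  have := integral_mono (integrable_const _) (integrable_theta p) half_le_theta
  simpa [meanTheta] using this

lemma meanTheta_le : meanTheta p ≤ 2 / 3 := by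
  have := integral_mono (integrable_theta p) (integrable_const _) theta_le
  simpa [meanTheta] using this

/-- The largest eigenvalue of the matrix with rows `(1 + m, m)` and `(1, 1)`. -/
def growth (m : ℝ) : ℝ := (2 + m + √(m ^ 2 + 4 * m)) / 2

lemma growth_eq {m : ℝ} (hm : 0 ≤ m) : growth m ^ 2 = (2 + m) * growth m - 1 := by
  have := Real.sq_sqrt (by positivity : 0 ≤ m ^ 2 + 4 * m)
  rw [growth]
  linarith

lemma two_le_growth {m : ℝ} (hm : 1 / 2 ≤ m) : 2 ≤ growth m := by
  have : 3 / 2 ≤ √(m ^ 2 + 4 * m) := Real.le_sqrt_of_sq_le (by nlinarith)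
  rw [growth]
  linarith

/-- Here `(l - 1, 1)` is a right eigenvector, with eigenvalue `l`, of the mean matrix. Jensen is
applied to one matrix at a time: the pairing with this vector is affine in `θ`, and its mean gains a
factor `l`. The start uses `l ≥ 2`, so that `(1, 1) ≤ (l - 1, 1)`. -/
lemma le_matrixMoment (n : ℕ) {r₁ r₂ : ℝ} (hr₁ : 0 < r₁) (hr₂ : 0 < r₂) :
    ENNReal.ofReal (((growth (meanTheta p) ^ n *
      (r₁ * (growth (meanTheta p) - 1) + r₂)) ^ 2)⁻¹) ≤ matrixMoment p n r₁ r₂ := by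
  have hm := half_le_meanTheta (p := p)
  have hg := two_le_growth hm
  have heq := growth_eq (by linarith : 0 ≤ meanTheta p)
  set l := growth (meanTheta p)
  induction n generalizing r₁ r₂ with
  | zero =>
    rw [matrixMoment, pow_zero, one_mul]
    refine ENNReal.ofReal_le_ofReal (inv_anti₀ (by positivity)
      (pow_le_pow_left₀ (by positivity) ?_ 2))
    nlinarith
  | succ n ih =>
    rw [matrixMoment]
    refine le_trans ?_ (lintegral_mono fun ω => ih
      (r₁ := r₁ * (1 + theta ω) + r₂) (r₂ := r₁ * theta ω + r₂)
      (by have := theta_pos ω; positivity) (by have := theta_pos ω; positivity))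
    have hl1 : 0 < l - 1 := by linarith
    have hX : Integrable (fun ω => l ^ n * ((r₁ * (1 + theta ω) + r₂) * (l - 1) +
        (r₁ * theta ω + r₂))) (branchingMeasure p) := by
      have e : (fun ω => l ^ n * ((r₁ * (1 + theta ω) + r₂) * (l - 1) +
          (r₁ * theta ω + r₂))) =
          fun ω => l ^ n * (r₁ * (l - 1) + r₂ * l) + l ^ n * r₁ * l * theta ω := by
        funext ω; ring
      rw [e]
      exact (integrable_const _).add ((integrable_theta p).const_mul _)
    refine le_trans (le_of_eq ?_) (ofReal_inv_sq_integral_le hX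
      (c := l ^ n * (r₁ * (l - 1))) (by positivity) fun ω => ?_)
    · congr 3
      have e : ∀ ω, l ^ n * ((r₁ * (1 + theta ω) + r₂) * (l - 1) + (r₁ * theta ω + r₂)) =
          l ^ n * (r₁ * (l - 1) + r₂ * l) + l ^ n * r₁ * l * theta ω := by
        intro ω; ring
      simp only [e]
      rw [integral_add (integrable_const _) ((integrable_theta p).const_mul _), integral_const,
        integral_const_mul]
      change _ = _ + l ^ n * r₁ * l * meanTheta p
      simp only [probReal_univ, one_smul]
      rw [pow_succ]
      linear_combination (l ^ n * r₁) * heq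
    · have := theta_pos ω
      refine mul_le_mul_of_nonneg_left ?_ (by positivity)
      nlinarith [mul_pos hr₁ hl1, mul_pos (mul_pos hr₁ hl1) this, mul_pos hr₂ hl1,
        mul_pos hr₁ this]

/-- `E Qₙ⁻²` for the sum `Qₙ` of the entries of the product of `n` random matrices. -/
def moment (p : unitInterval) (n : ℕ) : ℝ := (matrixMoment p n 1 1).toReal

lemma matrixMoment_one_ne_top (n : ℕ) : matrixMoment p n 1 1 ≠ ⊤ :=
  ((matrixMoment_le_zero n one_pos one_pos).trans_lt ENNReal.ofReal_lt_top).ne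

lemma le_moment (n : ℕ) :
    ((growth (meanTheta p) ^ n * growth (meanTheta p)) ^ 2)⁻¹ ≤ moment p n := by
  have h := le_matrixMoment (p := p) n one_pos one_pos
  rw [one_mul, sub_add_cancel] at h
  exact (ENNReal.ofReal_le_iff_le_toReal (matrixMoment_one_ne_top n)).1 h

lemma growth_pos : 0 < growth (meanTheta p) := by
  linarith [two_le_growth (half_le_meanTheta (p := p))]

lemma moment_pos (n : ℕ) : 0 < moment p n := by
  have := growth_pos (p := p)
  exact lt_of_lt_of_le (by positivity) (le_moment n)

lemma moment_le_one (n : ℕ) : moment p n ≤ 1 := by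
  refine ENNReal.toReal_le_of_le_ofReal zero_le_one
    ((matrixMoment_le_zero n one_pos one_pos).trans (ENNReal.ofReal_le_ofReal ?_))
  norm_num

lemma moment_mul_le (n m : ℕ) : moment p n * moment p m ≤ moment p (n + m) := by
  rw [moment, moment, ← ENNReal.toReal_mul]
  exact ENNReal.toReal_mono (matrixMoment_one_ne_top _) (matrixMoment_mul_le n m one_pos one_pos)

lemma exists_rate (p : unitInterval) : ∃ L : ℝ,
    Tendsto (fun n : ℕ => -Real.log (moment p n) / n) atTop (𝓝 L) ∧
      L ≤ Real.log (growth (meanTheta p) ^ 2) := by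
  have hsub : Subadditive fun n => -Real.log (moment p n) := by
    intro n m
    have h := Real.log_le_log (mul_pos (moment_pos n) (moment_pos m)) (moment_mul_le (p := p) n m)
    rw [Real.log_mul (moment_pos n).ne' (moment_pos m).ne'] at h
    linarith
  have hbdd : BddBelow (Set.range fun n : ℕ => -Real.log (moment p n) / n) := by
    refine ⟨0, ?_⟩
    rintro _ ⟨n, rfl⟩
    have := Real.log_nonpos (moment_pos n).le (moment_le_one (p := p) n)
    exact div_nonneg (by linarith) (by positivity)
  refine ⟨hsub.lim, hsub.tendsto_lim hbdd, ?_⟩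
  -- The lower bound on the moment is `l ^ (-2(n + 1))`; the surplus factor contributes the term
  -- that vanishes after division by `n`.
  have hlim : Tendsto (fun n : ℕ => Real.log (growth (meanTheta p) ^ 2) +
      Real.log (growth (meanTheta p) ^ 2) / n) atTop
      (𝓝 (Real.log (growth (meanTheta p) ^ 2) + 0)) :=
    tendsto_const_nhds.add (tendsto_const_div_atTop_nhds_zero_nat _)
  rw [add_zero] at hlim
  refine le_of_tendsto_of_tendsto (hsub.tendsto_lim hbdd) hlim ?_
  filter_upwards [eventually_gt_atTop 0] with n hn
  have hn' : (0 : ℝ) < n := by exact_mod_cast hn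
  have hg := growth_pos (p := p)
  have h := Real.log_le_log (by positivity) (le_moment (p := p) n)
  rw [Real.log_inv, ← pow_succ, ← pow_mul, Real.log_pow] at h
  rw [Real.log_pow, div_le_iff₀ hn', add_mul, div_mul_cancel₀ _ hn'.ne']
  push_cast at h ⊢
  linarith

/-! ### The annealed covariance -/

/-- `E (K 1_{v ∈ 𝒯})` for the kernel `K` of the vertex `v`. -/
def kernelMoment (p : unitInterval) (v : Vertex) (r₁ r₂ : ℝ) : ENNReal :=
  ∫⁻ ω in {ω | v ∈ randomTree ω}, ENNReal.ofReal (pathKernel v r₁ r₂ (randomTree ω))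
    ∂(branchingMeasure p)

lemma measurable_pathKernel (v : Vertex) :
    Measurable fun x : (ℝ × ℝ) × Branching => pathKernel v x.1.1 x.1.2 (randomTree x.2) := by
  have h1 := (measurable_pathDelta v).comp (measurable_snd : Measurable (Prod.snd : (ℝ × ℝ) × Branching → Branching))
  have h2 := measurable_treeRatio.comp (measurable_snd : Measurable (Prod.snd : (ℝ × ℝ) × Branching → Branching))
  exact h1.div (((measurable_fst.comp measurable_fst).add
    ((measurable_snd.comp measurable_fst).mul h2)).pow_const 2)

/-- The vertex `b :: v` is present iff the root branches and `v` is present below `[b]`; the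
off-path family below `[!b]` remains unconditioned and independent. -/
lemma setLIntegral_cons (b : Bool) (v : Vertex) {F : Branching × Branching → ENNReal}
    (hF : Measurable F) :
    ∫⁻ ω in {ω | b :: v ∈ randomTree ω}, F (tailBranching (!b) ω, tailBranching b ω)
        ∂(branchingMeasure p) =
      ENNReal.ofReal p * ∫⁻ ω, ∫⁻ ω' in {ω | v ∈ randomTree ω}, F (ω, ω')
        ∂(branchingMeasure p) ∂(branchingMeasure p) := by
  have hv := measurableSet_mem_randomTree v
  have hset : {ω | b :: v ∈ randomTree ω} =
      tailBranching b ⁻¹' {ω | v ∈ randomTree ω} ∩ {ω | ω [] = true} := by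
    ext ω
    simp [cons_mem_randomTree, and_comm]
  have h := lintegral_branching_node p b
    (F := (Prod.snd ⁻¹' {ω | v ∈ randomTree ω}).indicator F)
    (hF.indicator (measurable_snd hv))
  rw [hset, ← Measure.restrict_restrict (measurable_tailBranching b hv),
    ← lintegral_indicator (measurable_tailBranching b hv)]
  simp only [← lintegral_indicator hv]
  exact h

lemma measure_mem_randomTree (v : Vertex) :
    branchingMeasure p {ω | v ∈ randomTree ω} = ENNReal.ofReal p ^ v.length := by
  induction v with
  | nil => simp [nil_mem_randomTree]
  | cons b v ih =>
    have h := setLIntegral_cons (p := p) b v (F := fun _ => 1) measurable_const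
    simp only [lintegral_const, one_mul, Measure.restrict_apply_univ, ih, measure_univ,
      mul_one] at h
    rw [h, List.length_cons, pow_succ']

/-- This is the recursion of `matrixMoment` with one factor `p` per generation; that factor is
cancelled later by the conditioning. -/
lemma kernelMoment_cons {b : Bool} {v : Vertex} {r₁ r₂ : ℝ} (hr₁ : 0 < r₁) (hr₂ : 0 < r₂) :
    kernelMoment p (b :: v) r₁ r₂ = ENNReal.ofReal p *
      ∫⁻ ω, kernelMoment p v (r₁ * (1 + theta ω) + r₂) (r₁ * theta ω + r₂)
        ∂(branchingMeasure p) := by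
  have hF : Measurable fun x : Branching × Branching => ENNReal.ofReal
      (pathKernel v (r₁ * (1 + theta x.1) + r₂) (r₁ * theta x.1 + r₂) (randomTree x.2)) := by
    have ht := measurable_theta
    exact ENNReal.measurable_ofReal.comp ((measurable_pathKernel v).comp (by fun_prop :
      Measurable fun x : Branching × Branching =>
        ((r₁ * (1 + theta x.1) + r₂, r₁ * theta x.1 + r₂), x.2)))
  rw [kernelMoment]
  simp only [kernelMoment]
  rw [← setLIntegral_cons b v hF]
  refine setLIntegral_congr_fun (measurableSet_mem_randomTree _) fun ω hω => ?_
  have h0 := (cons_mem_randomTree.1 hω).1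
  simp only [pathKernel_cons hr₁ hr₂.le (nil_mem_randomTree ω), branch_randomTree h0]
  rfl

lemma kernelMoment_bounds (v : Vertex) {r₁ r₂ : ℝ} (hr₁ : 0 < r₁) (hr₂ : 0 < r₂) :
    ENNReal.ofReal (1 / 16) * (ENNReal.ofReal p ^ v.length * matrixMoment p v.length r₁ r₂) ≤
        kernelMoment p v r₁ r₂ ∧
      kernelMoment p v r₁ r₂ ≤
        ENNReal.ofReal 52 * (ENNReal.ofReal p ^ v.length * matrixMoment p v.length r₁ r₂) := by
  induction v generalizing r₁ r₂ with
  | nil =>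
    simp only [kernelMoment, nil_mem_randomTree, Set.ofPred_true, Measure.restrict_univ,
      List.length_nil, pow_zero, one_mul, matrixMoment]
    rw [← ENNReal.ofReal_mul (by norm_num), ← ENNReal.ofReal_mul (by norm_num)]
    have hlow : ∀ ω, 1 / 16 * ((r₁ + r₂) ^ 2)⁻¹ ≤ pathKernel [] r₁ r₂ (randomTree ω) := by
      intro ω
      have h1 := half_le_treeRatio ω
      have h2 := treeRatio_le_one ω
      have h3 := (pathDelta_nil_mem (randomTree ω)).1
      rw [pathKernel, div_eq_mul_inv]
      change 1 / 2 ≤ ratioLim (randomTree ω) at h1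
      change ratioLim (randomTree ω) ≤ 1 at h2
      refine mul_le_mul h3 (inv_anti₀ (by positivity)
        (pow_le_pow_left₀ (by positivity) (by nlinarith) 2)) (by positivity) (by linarith)
    have hupp : ∀ ω, pathKernel [] r₁ r₂ (randomTree ω) ≤ 52 * ((r₁ + r₂) ^ 2)⁻¹ := by
      intro ω
      have h1 := half_le_treeRatio ω
      have h3 := (pathDelta_nil_mem (randomTree ω)).2
      rw [pathKernel, ← div_eq_mul_inv]
      change 1 / 2 ≤ ratioLim (randomTree ω) at h1
      rw [div_le_div_iff₀ (by positivity) (by positivity)]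
      -- The ratio is at least 1/2, so replacing it by 1 at most doubles the partition sum; hence
      -- `52 = 4 · 13`.
      have h4 : (r₁ + r₂) ^ 2 ≤ 4 * (r₁ + r₂ * ratioLim (randomTree ω)) ^ 2 := by
        have : r₁ + r₂ ≤ 2 * (r₁ + r₂ * ratioLim (randomTree ω)) := by nlinarith
        calc (r₁ + r₂) ^ 2 ≤ (2 * (r₁ + r₂ * ratioLim (randomTree ω))) ^ 2 :=
              pow_le_pow_left₀ (by positivity) this 2
          _ = _ := by ring
      calc pathDelta [] (randomTree ω) * (r₁ + r₂) ^ 2 ≤ 13 * (r₁ + r₂) ^ 2 :=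
            mul_le_mul_of_nonneg_right h3 (by positivity)
        _ ≤ 13 * (4 * (r₁ + r₂ * ratioLim (randomTree ω)) ^ 2) := by linarith
        _ = _ := by ring
    constructor
    · refine le_trans (by simp) (lintegral_mono (μ := branchingMeasure p)
        (f := fun _ => ENNReal.ofReal (1 / 16 * ((r₁ + r₂) ^ 2)⁻¹))
        fun ω => ENNReal.ofReal_le_ofReal (hlow ω))
    · refine (lintegral_mono (μ := branchingMeasure p)
        (g := fun _ => ENNReal.ofReal (52 * ((r₁ + r₂) ^ 2)⁻¹))
        fun ω => ENNReal.ofReal_le_ofReal (hupp ω)).trans (by simp)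
  | cons b v ih =>
    have key : ∀ c : ENNReal, c ≠ ⊤ → ENNReal.ofReal p * ∫⁻ ω,
        c * (ENNReal.ofReal p ^ v.length *
          matrixMoment p v.length (r₁ * (1 + theta ω) + r₂) (r₁ * theta ω + r₂))
          ∂(branchingMeasure p) =
        c * (ENNReal.ofReal p ^ (b :: v).length * matrixMoment p (b :: v).length r₁ r₂) := by
      intro c hc
      rw [lintegral_const_mul' _ _ hc, lintegral_const_mul' _ _
        (ENNReal.pow_ne_top ENNReal.ofReal_ne_top), List.length_cons, matrixMoment, pow_succ]
      ring
    rw [kernelMoment_cons hr₁ hr₂, ← key _ ENNReal.ofReal_ne_top, ← key _ ENNReal.ofReal_ne_top]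
    constructor <;> refine mul_le_mul_right (lintegral_mono fun ω => ?_) _ <;>
      have ht := theta_pos ω
    · exact (ih (by positivity) (by positivity)).1
    · exact (ih (by positivity) (by positivity)).2

/-- `E (|Cov| 1_{v ∈ 𝒯})`. -/
def covMoment (p : unitInterval) (v : Vertex) : ENNReal :=
  ∫⁻ ω in {ω | v ∈ randomTree ω}, ENNReal.ofReal |covFormula v (randomTree ω)|
    ∂(branchingMeasure p)

lemma covMoment_cons (b : Bool) (v : Vertex) : covMoment p (b :: v) = ENNReal.ofReal p *
    ∫⁻ ω, ENNReal.ofReal (3 + 3 * treeRatio ω + treeRatio ω ^ 2) *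
      kernelMoment p v (3 + 2 * treeRatio ω) (2 + treeRatio ω) ∂(branchingMeasure p) := by
  have ht := measurable_treeRatio
  have hF : Measurable fun x : Branching × Branching =>
      ENNReal.ofReal (3 + 3 * treeRatio x.1 + treeRatio x.1 ^ 2) * ENNReal.ofReal
      (pathKernel v (3 + 2 * treeRatio x.1) (2 + treeRatio x.1) (randomTree x.2)) := by
    have h := ENNReal.measurable_ofReal.comp ((measurable_pathKernel v).comp (by fun_prop :
      Measurable fun x : Branching × Branching =>
        ((3 + 2 * treeRatio x.1, 2 + treeRatio x.1), x.2)))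
    exact Measurable.mul (by fun_prop) h
  have e : ∀ ω, ENNReal.ofReal (3 + 3 * treeRatio ω + treeRatio ω ^ 2) *
      kernelMoment p v (3 + 2 * treeRatio ω) (2 + treeRatio ω) =
      ∫⁻ ω' in {ω | v ∈ randomTree ω},
        ENNReal.ofReal (3 + 3 * treeRatio ω + treeRatio ω ^ 2) * ENNReal.ofReal
        (pathKernel v (3 + 2 * treeRatio ω) (2 + treeRatio ω) (randomTree ω'))
        ∂(branchingMeasure p) := fun ω =>
    (lintegral_const_mul' _ _ ENNReal.ofReal_ne_top).symm
  simp only [e]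
  rw [← setLIntegral_cons b v hF, covMoment]
  refine setLIntegral_congr_fun (measurableSet_mem_randomTree _) fun ω hω => ?_
  have h0 := (cons_mem_randomTree.1 hω).1
  have h1 := half_le_treeRatio (tailBranching (!b) ω)
  simp only [covFormula, abs_neg, branch_randomTree h0]
  change ENNReal.ofReal |(3 + 3 * treeRatio (tailBranching (!b) ω) +
    treeRatio (tailBranching (!b) ω) ^ 2) * pathKernel v _ _ _| = _
  have h2 := pathKernel_pos v (r₁ := 3 + 2 * treeRatio (tailBranching (!b) ω))
    (r₂ := 2 + treeRatio (tailBranching (!b) ω)) (by positivity) (by positivity)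
    (randomTree (tailBranching b ω))
  rw [← ENNReal.ofReal_mul (by positivity)]
  congr 1
  exact abs_of_pos (mul_pos (by positivity) h2)

/-- The row at the first step lies between `(1, 1)` and `(5, 5)`, and the prefactor between 3 and 7.
Hence `3/400 = 3 · (1/16) · (1/25)` and `364 = 7 · 52`. -/
lemma covMoment_bounds (b : Bool) (v : Vertex) :
    ENNReal.ofReal (3 / 400) * (ENNReal.ofReal p ^ (v.length + 1) *
        matrixMoment p v.length 1 1) ≤ covMoment p (b :: v) ∧
      covMoment p (b :: v) ≤ ENNReal.ofReal 364 * (ENNReal.ofReal p ^ (v.length + 1) *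
        matrixMoment p v.length 1 1) := by
  rw [covMoment_cons]
  set P := ENNReal.ofReal p with hP
  set M := matrixMoment p v.length 1 1 with hM
  have hlow : ∀ ω, ENNReal.ofReal (3 / 400) * (P ^ v.length * M) ≤
      ENNReal.ofReal (3 + 3 * treeRatio ω + treeRatio ω ^ 2) *
      kernelMoment p v (3 + 2 * treeRatio ω) (2 + treeRatio ω) := by
    intro ω
    have h1 := half_le_treeRatio ω
    have h2 := treeRatio_le_one ω
    have h3 := (kernelMoment_bounds (p := p) v (r₁ := 3 + 2 * treeRatio ω)
      (r₂ := 2 + treeRatio ω) (by positivity) (by positivity)).1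
    have h4 := matrixMoment_le_of_le (p := p) v.length (r₁ := 3 + 2 * treeRatio ω)
      (r₂ := 2 + treeRatio ω) (s₁ := 5) (s₂ := 5) (c := 1) (by positivity) (by positivity)
      (by linarith) (by linarith) (by norm_num) (by norm_num)
    have h5 := matrixMoment_le_of_le (p := p) v.length (r₁ := 5)
      (r₂ := 5) (s₁ := 1) (s₂ := 1) (c := 5) (by positivity) (by positivity)
      (by linarith) (by linarith) (by norm_num) (by norm_num)
    rw [one_pow, ENNReal.ofReal_one, one_mul] at h4
    have h6 : ENNReal.ofReal (1 / 25) * M ≤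
        matrixMoment p v.length (3 + 2 * treeRatio ω) (2 + treeRatio ω) := by
      refine le_trans (mul_le_mul_right h5 _) (le_trans (le_of_eq ?_) h4)
      rw [← mul_assoc, ← ENNReal.ofReal_mul (by norm_num)]
      norm_num
    calc ENNReal.ofReal (3 / 400) * (P ^ v.length * M) =
        ENNReal.ofReal 3 * (ENNReal.ofReal (1 / 16) * (P ^ v.length *
          (ENNReal.ofReal (1 / 25) * M))) := by
          rw [show (3 / 400 : ℝ) = 3 * (1 / 16) * (1 / 25) by norm_num,
            ENNReal.ofReal_mul (by norm_num), ENNReal.ofReal_mul (by norm_num)]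
          ring
      _ ≤ _ := by
          gcongr
          · nlinarith
          · exact le_trans (by gcongr) h3
  have hupp : ∀ ω, ENNReal.ofReal (3 + 3 * treeRatio ω + treeRatio ω ^ 2) *
      kernelMoment p v (3 + 2 * treeRatio ω) (2 + treeRatio ω) ≤
      ENNReal.ofReal 364 * (P ^ v.length * M) := by
    intro ω
    have h1 := half_le_treeRatio ω
    have h2 := treeRatio_le_one ω
    have h3 := (kernelMoment_bounds (p := p) v (r₁ := 3 + 2 * treeRatio ω)
      (r₂ := 2 + treeRatio ω) (by positivity) (by positivity)).2
    have h4 := matrixMoment_le_of_le (p := p) v.length (s₁ := 3 + 2 * treeRatio ω)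
      (s₂ := 2 + treeRatio ω) (r₁ := 1) (r₂ := 1) (c := 1) (by positivity) (by positivity)
      (by linarith) (by linarith) (by positivity) (by positivity)
    rw [one_pow, ENNReal.ofReal_one, one_mul] at h4
    calc _ ≤ ENNReal.ofReal 7 * (ENNReal.ofReal 52 * (P ^ v.length * M)) := by
          gcongr
          · nlinarith
          · exact le_trans h3 (by gcongr)
      _ = _ := by
          rw [← mul_assoc, ← ENNReal.ofReal_mul (by norm_num)]
          norm_num
  constructor
  · calc _ = P * ∫⁻ _, ENNReal.ofReal (3 / 400) * (P ^ v.length * M) ∂(branchingMeasure p) := by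
          simp only [lintegral_const, measure_univ, mul_one, pow_succ]
          ring
      _ ≤ _ := mul_le_mul_right (lintegral_mono hlow) _
  · calc _ ≤ P * ∫⁻ _, ENNReal.ofReal 364 * (P ^ v.length * M) ∂(branchingMeasure p) :=
          mul_le_mul_right (lintegral_mono hupp) _
      _ = _ := by
          simp only [lintegral_const, measure_univ, mul_one, pow_succ]
          ring

lemma abs_covFormula_pos (v : Vertex) (T : Set Vertex) : 0 < |covFormula v T| := by
  rcases v with _ | ⟨b, v⟩
  · exact abs_pos.2 (covFormula_nil_pos T).ne'
  · exact abs_pos.2 (covFormula_cons_neg b v T).ne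

lemma measure_mem_randomTree_ne_zero (hp : 0 < p) (v : Vertex) :
    branchingMeasure p {ω | v ∈ randomTree ω} ≠ 0 := by
  rw [measure_mem_randomTree]
  exact pow_ne_zero _ (ENNReal.ofReal_pos.2 hp).ne'

lemma isProbabilityMeasure_conditionedMeasure (hp : 0 < p) (v : Vertex) :
    IsProbabilityMeasure (conditionedMeasure p v) :=
  cond_isProbabilityMeasure (measure_mem_randomTree_ne_zero hp v)

lemma ae_mem_randomTree (v : Vertex) : ∀ᵐ ω ∂(conditionedMeasure p v), v ∈ randomTree ω :=
  ae_cond_mem (measurableSet_mem_randomTree v)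

lemma covFormula_nil_le (T : Set Vertex) : |covFormula [] T| ≤ 14 := by
  have p0 := ratioLim_nonneg (branch false T)
  have q0 := ratioLim_nonneg (branch true T)
  have p1 := ratioLim_le_one (branch false T)
  have q1 := ratioLim_le_one (branch true T)
  rw [abs_of_pos (covFormula_nil_pos T), covFormula]
  generalize ratioLim (branch false T) = y at *
  generalize ratioLim (branch true T) = z at *
  have hq : 0 ≤ y * z := mul_nonneg p0 q0
  rw [div_le_iff₀ (by positivity)]
  generalize y * z = q at *
  have ht : 0 ≤ y + z := by linarith
  generalize y + z = t at *
  nlinarith [mul_nonneg ht hq]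

/-- A family of sandpile measures. -/
def sandpileFamily (T : Set Vertex) : ProbabilityMeasure Config := by
  classical
  exact if h : IsRootedSubtree T then (exists_isSandpileMeasure h).choose
    -- An arbitrary value for sets that are not rooted subtrees.
    else finiteSandpileMeasure ∅

lemma isSandpileMeasure_sandpileFamily {T : Set Vertex} (hT : IsRootedSubtree T) :
    IsSandpileMeasure T (sandpileFamily T) := by
  rw [sandpileFamily, dif_pos hT]
  exact (exists_isSandpileMeasure hT).choose_spec

lemma heightCov_ae_eq (v : Vertex) :
    (fun ω => heightCov (sandpileFamily (randomTree ω)) [] v) =ᵐ[conditionedMeasure p v]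
      fun ω => covFormula v (randomTree ω) := by
  filter_upwards [ae_mem_randomTree v] with ω hω
  exact heightCov_eq (isRootedSubtree_randomTree ω)
    (isSandpileMeasure_sandpileFamily (isRootedSubtree_randomTree ω)) hω

lemma lintegral_covFormula (v : Vertex) :
    ∫⁻ ω, ENNReal.ofReal |covFormula v (randomTree ω)| ∂(conditionedMeasure p v) =
      (ENNReal.ofReal p ^ v.length)⁻¹ * covMoment p v := by
  rw [conditionedMeasure, ProbabilityTheory.cond, lintegral_smul_measure, measure_mem_randomTree]
  rfl

/-- The probability `p ^ |b :: v|` of the conditioning event cancels the powers of `p` in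
`covMoment_bounds`. -/
lemma moment_bounds (hp : 0 < p) (b : Bool) (v : Vertex) :
    ENNReal.ofReal (3 / 400 * moment p v.length) ≤
        ∫⁻ ω, ENNReal.ofReal |covFormula (b :: v) (randomTree ω)|
          ∂(conditionedMeasure p (b :: v)) ∧
      ∫⁻ ω, ENNReal.ofReal |covFormula (b :: v) (randomTree ω)|
          ∂(conditionedMeasure p (b :: v)) ≤ ENNReal.ofReal (364 * moment p v.length) := by
  have hP : ENNReal.ofReal p ^ (v.length + 1) ≠ 0 := pow_ne_zero _ (ENNReal.ofReal_pos.2 hp).ne'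
  have hP' : ENNReal.ofReal p ^ (v.length + 1) ≠ ⊤ := ENNReal.pow_ne_top ENNReal.ofReal_ne_top
  have key : ∀ c : ℝ, 0 ≤ c → ENNReal.ofReal (c * moment p v.length) =
      (ENNReal.ofReal p ^ (v.length + 1))⁻¹ * (ENNReal.ofReal c *
        (ENNReal.ofReal p ^ (v.length + 1) * matrixMoment p v.length 1 1)) := by
    intro c hc
    rw [ENNReal.ofReal_mul hc, moment, ENNReal.ofReal_toReal (matrixMoment_one_ne_top _),
      mul_left_comm (ENNReal.ofReal c), ← mul_assoc, ENNReal.inv_mul_cancel hP hP', one_mul]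
  rw [lintegral_covFormula, key _ (by norm_num), key _ (by norm_num), List.length_cons]
  exact ⟨mul_le_mul_right (covMoment_bounds b v).1 _, mul_le_mul_right (covMoment_bounds b v).2 _⟩

lemma integrable_covFormula (hp : 0 < p) (v : Vertex) :
    Integrable (fun ω => covFormula v (randomTree ω)) (conditionedMeasure p v) := by
  have := isProbabilityMeasure_conditionedMeasure hp v
  have hm := (measurable_covFormula v).aestronglyMeasurable (μ := conditionedMeasure p v)
  rcases v with _ | ⟨b, v⟩
  · exact Integrable.of_bound hm 14 (Eventually.of_forall fun ω => covFormula_nil_le _)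
  · refine ⟨hm, ?_⟩
    rw [hasFiniteIntegral_iff_norm]
    exact (moment_bounds hp b v).2.trans_lt ENNReal.ofReal_lt_top

lemma annealedAbsCov_eq (v : Vertex) : annealedAbsCov p sandpileFamily v =
    ∫ ω, |covFormula v (randomTree ω)| ∂(conditionedMeasure p v) := by
  refine integral_congr_ae ?_
  filter_upwards [heightCov_ae_eq v] with ω hω
  rw [hω]

lemma annealedAbsCov_pos (hp : 0 < p) (v : Vertex) : 0 < annealedAbsCov p sandpileFamily v := by
  have := isProbabilityMeasure_conditionedMeasure hp v
  rw [annealedAbsCov_eq, integral_pos_iff_support_of_nonneg (fun ω => abs_nonneg _)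
    (integrable_covFormula hp v).abs]
  have : Function.support (fun ω => |covFormula v (randomTree ω)|) = Set.univ :=
    Set.eq_univ_of_forall fun ω => (abs_covFormula_pos v _).ne'
  rw [this, measure_univ]
  exact one_pos

lemma annealedAbsCov_bounds (hp : 0 < p) (b : Bool) (v : Vertex) :
    3 / 400 * moment p v.length ≤ annealedAbsCov p sandpileFamily (b :: v) ∧
      annealedAbsCov p sandpileFamily (b :: v) ≤ 364 * moment p v.length := by
  have h := moment_bounds hp b v
  have hm := moment_pos (p := p) v.length
  rw [← ofReal_integral_eq_lintegral_ofReal (integrable_covFormula hp _).abs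
    (Eventually.of_forall fun ω => abs_nonneg _), ← annealedAbsCov_eq] at h
  exact ⟨(ENNReal.ofReal_le_ofReal_iff (annealedAbsCov_pos hp _).le).1 h.1,
    (ENNReal.ofReal_le_ofReal_iff (by positivity)).1 h.2⟩

/-! ### Eigenvalue identities and the limit of the rate. -/

/-- With `γ = m⁻¹` one has `Λ₊ = γ l` for `l = growth m`, and `Λ₊ Λ₋ = γ²`; hence `Λ₋ = γ / l`. -/
lemma LambdaPlus_div_LambdaMinus {m : ℝ} (hm : 0 < m) :
    LambdaPlus m⁻¹ / LambdaMinus m⁻¹ = growth m ^ 2 := by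
  have hs : √(m ^ 2 + 4 * m) = m * √(4 * m⁻¹ + 1) := by
    rw [show m ^ 2 + 4 * m = m ^ 2 * (4 * m⁻¹ + 1) by field_simp; ring,
      Real.sqrt_mul (sq_nonneg m), Real.sqrt_sq hm.le]
  have hplus : LambdaPlus m⁻¹ = growth m / m := by
    rw [LambdaPlus, growth, hs]
    field_simp
  have hsq := Real.sq_sqrt (by positivity : 0 ≤ 4 * m⁻¹ + 1)
  have hprod : LambdaPlus m⁻¹ * LambdaMinus m⁻¹ = (m⁻¹) ^ 2 := by
    rw [LambdaPlus, LambdaMinus]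
    linear_combination -(1 / 4 : ℝ) * hsq
  have hg : 0 < growth m := by rw [growth]; positivity
  have hminus : LambdaMinus m⁻¹ = (growth m * m)⁻¹ := by
    rw [hplus] at hprod
    field_simp at hprod ⊢
    linarith
  rw [hplus, hminus]
  field_simp

lemma growth_sq_le {m : ℝ} (hm0 : 0 ≤ m) (hm : m ≤ 2 / 3) :
    growth m ^ 2 ≤ (4 + √7) / (4 - √7) := by
  have h7 := Real.sq_sqrt (by norm_num : (0 : ℝ) ≤ 7)
  have h7' : 0 ≤ √7 := Real.sqrt_nonneg 7
  have h7'' : √7 < 4 := by nlinarith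
  have hs : √(m ^ 2 + 4 * m) ≤ 2 * √7 / 3 := Real.sqrt_le_iff.2 ⟨by positivity, by nlinarith⟩
  have hg : growth m ≤ (4 + √7) / 3 := by rw [growth]; linarith
  have hg0 : 0 ≤ growth m := by rw [growth]; positivity
  calc growth m ^ 2 ≤ ((4 + √7) / 3) ^ 2 := pow_le_pow_left₀ hg0 hg 2
    _ = (4 + √7) / (4 - √7) := by
      rw [eq_div_iff (by linarith)]
      linear_combination (-(4 + √7) / 9) * h7

lemma tendsto_annealedAbsCov (hp : 0 < p) {v : ℕ → Vertex} (hv : ∀ n, (v n).length = n) {L : ℝ}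
    (hL : Tendsto (fun n : ℕ => -Real.log (moment p n) / n) atTop (𝓝 L)) :
    Tendsto (fun n : ℕ => (1 / (n : ℝ)) *
      (-Real.log (annealedAbsCov p sandpileFamily (v n)))) atTop (𝓝 L) := by
  -- A vertex at distance `n + 1` corresponds to `moment p n`, since the root contributes only the
  -- prefactor. The constants of the two-sided bound vanish after division by `n + 1`.
  rw [← tendsto_add_atTop_iff_nat 1]
  have hfrac : Tendsto (fun n : ℕ => (n : ℝ) / ((n + 1 : ℕ) : ℝ)) atTop (𝓝 1) := by
    simpa using tendsto_natCast_div_add_atTop (1 : ℝ)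
  have hmain : Tendsto (fun n : ℕ => -Real.log (moment p n) / ((n + 1 : ℕ) : ℝ)) atTop (𝓝 L) := by
    have h := hL.mul hfrac
    rw [mul_one] at h
    refine h.congr' ?_
    filter_upwards [eventually_gt_atTop 0] with n hn
    have : (n : ℝ) ≠ 0 := by exact_mod_cast hn.ne'
    field_simp
  have hconst : ∀ c : ℝ, Tendsto (fun n : ℕ => c / ((n + 1 : ℕ) : ℝ)) atTop (𝓝 0) := fun c =>
    (tendsto_const_div_atTop_nhds_zero_nat c).comp (tendsto_add_atTop_nat 1)
  have hlow := hmain.sub (hconst (Real.log 364))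
  have hupp := hmain.sub (hconst (Real.log (3 / 400)))
  rw [sub_zero] at hlow hupp
  refine tendsto_of_tendsto_of_tendsto_of_le_of_le hlow hupp (fun n => ?_) (fun n => ?_)
  all_goals
    obtain ⟨b, w, hw⟩ : ∃ b w, v (n + 1) = b :: w :=
      List.exists_cons_of_length_eq_add_one (hv (n + 1))
    have hwn : w.length = n := by have := hv (n + 1); rw [hw] at this; simpa using this
    have hbd := annealedAbsCov_bounds hp b w
    rw [hwn] at hbd
    have hm := moment_pos (p := p) n
    have hpos := annealedAbsCov_pos hp (b :: w)
    simp only [hw, one_div, ← sub_div]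
    rw [div_eq_inv_mul]
    refine mul_le_mul_of_nonneg_left ?_ (by positivity)
  · have h := Real.log_le_log hpos hbd.2
    rw [Real.log_mul (by norm_num) hm.ne'] at h
    linarith
  · have h := Real.log_le_log (by positivity) hbd.1
    rw [Real.log_mul (by norm_num) hm.ne'] at h
    linarith

end TreeSandpile

end

theorem theorem6p2 (p : unitInterval) (hp : 0 < p) (v : ℕ → TreeSandpile.Vertex)
    (hv : ∀ n, (v n).length = n) :
    ∃ (ν : ProbabilityMeasure ℝ)
      (μ : Set TreeSandpile.Vertex → ProbabilityMeasure TreeSandpile.Config),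
      -- the characteristic ratio of the tree of `N` generations has the limiting law `ν`
      TendstoInDistribution
        (fun (N : ℕ) ω => TreeSandpile.charRatio (TreeSandpile.randomTreeUpTo N ω)) atTop
        (id : ℝ → ℝ) (fun _ => TreeSandpile.branchingMeasure p) (ν : Measure ℝ) ∧
      -- the sandpile measure `μ T` of every finite or infinite rooted subtree `T` exists
      (∀ T, TreeSandpile.IsRootedSubtree T → TreeSandpile.IsSandpileMeasure T (μ T)) ∧
      -- the annealed covariances are well defined and do not vanish
      (∀ n, Integrable
        (fun ω => TreeSandpile.heightCov (μ (TreeSandpile.randomTree ω)) [] (v n))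
        (TreeSandpile.conditionedMeasure p (v n))) ∧
      (∀ n, 0 < TreeSandpile.annealedAbsCov p μ (v n)) ∧
      ∃ L : ℝ,
        Tendsto (fun n : ℕ => (1 / (n : ℝ)) *
          (-Real.log (TreeSandpile.annealedAbsCov p μ (v n)))) atTop (𝓝 L) ∧
        L ≤ Real.log (TreeSandpile.LambdaPlus (TreeSandpile.gammaOf ν) /
          TreeSandpile.LambdaMinus (TreeSandpile.gammaOf ν)) ∧
        Real.log (TreeSandpile.LambdaPlus (TreeSandpile.gammaOf ν) /
          TreeSandpile.LambdaMinus (TreeSandpile.gammaOf ν)) ≤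
            Real.log ((4 + √7) / (4 - √7)) := by
  obtain ⟨L, hL, hle⟩ := TreeSandpile.exists_rate p
  have hm := TreeSandpile.half_le_meanTheta (p := p)
  have hratio : TreeSandpile.LambdaPlus (TreeSandpile.gammaOf (TreeSandpile.ratioLaw p)) /
      TreeSandpile.LambdaMinus (TreeSandpile.gammaOf (TreeSandpile.ratioLaw p)) =
      TreeSandpile.growth (TreeSandpile.meanTheta p) ^ 2 := by
    rw [TreeSandpile.gammaOf_ratioLaw]
    exact TreeSandpile.LambdaPlus_div_LambdaMinus (lt_of_lt_of_le (by norm_num) hm)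
  refine ⟨TreeSandpile.ratioLaw p, TreeSandpile.sandpileFamily,
    TreeSandpile.tendstoInDistribution_charRatio p,
    fun T hT => TreeSandpile.isSandpileMeasure_sandpileFamily hT,
    fun n => (TreeSandpile.integrable_covFormula hp (v n)).congr
      (TreeSandpile.heightCov_ae_eq (v n)).symm,
    fun n => TreeSandpile.annealedAbsCov_pos hp (v n), L,
    TreeSandpile.tendsto_annealedAbsCov hp hv hL, ?_, ?_⟩
  · rwa [hratio]
  · rw [hratio]
    have := TreeSandpile.growth_pos (p := p)
    exact Real.log_le_log (by positivity)
      (TreeSandpile.growth_sq_le (by linarith) TreeSandpile.meanTheta_le)
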